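/- For $\lambda>0$ put $\varphi(\lambda)=\lambda-\log\lambda-1$, $\mu=\lambda-1$ and $\eta=\operatorname{sgn}(\lambda-1)\sqrt{2\varphi(\lambda)}$, and let $\Gamma(a,x)=\int_x^\infty e^{-t}t^{a-1}\,dt$ be the incomplete gamma function. Let $C_n(\eta)$ be the coefficients of Temme's uniform asymptotic expansion $$\frac{\Gamma(a,\lambda a)}{\Gamma(a)}\sim\frac12\operatorname{erfc}\Bigl(\eta\sqrt{a/2}\Bigr)+\frac{e^{-a\eta^2/2}}{\sqrt{2\pi a}}\sum_{n=0}^\infty\frac{C_n(\eta)}{a^n}\qquad(a\to+\infty),$$ which means that for every $N\ge 0$ the difference between the left-hand side and the right-hand side with the sum truncated to $n<N$ is $\frac{e^{-a\eta^2/2}}{\sqrt{2\pi a}}\,O(a^{-N})$ as $a\to+\infty$, uniformly in $\lambda>0$; and let $Q_n$ be the polynomials for which $$C_n(\eta)=(-1)^n\left(\frac{Q_n(\mu)}{\mu^{2n+1}}-\frac{2^n\Gamma(n+\frac12)}{\sqrt\pi\,\eta^{2n+1}}\right)\qquad(\lambda>0,\ \lambda\ne1).$$ Such functions $C_n$ and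 polynomials $Q_n$ exist, and necessarily $Q_n(\mu)=\sum_{k=0}^{2n}q_k^{(n)}\mu^k$ for every $n\ge0$, where $$q_k^{(n)}=\sum_{j=0}^k\frac{(-1)^k\,2^{n+j+1}\,\Gamma(n+k+\frac32)}{\sqrt\pi\,(2n+2j+1)\,(k-j)!}\sum_{i=0}^j\frac{(-1)^i\,s(k+j+i,i)}{(j-i)!\,(k+j+i)!},$$ and $s(m,i)$ denotes the signless Stirling numbers of the first kind. -/

import Mathlib

open scoped Nat

noncomputable section

namespace Temme

/-- The (upper) incomplete gamma function `Γ(a, x) = ∫_x^∞ e^{-t} t^{a-1} dt`, for `a > 0`, `x ≥ 0`. -/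
def incompleteGamma (a x : ℝ) : ℝ :=
  ∫ t in Set.Ioi x, Real.exp (-t) * t ^ (a - 1)

/-- The complementary error function `erfc x = (2 / √π) ∫_x^∞ e^{-t²} dt`. -/
def erfc (x : ℝ) : ℝ :=
  2 / √Real.pi * ∫ t in Set.Ioi x, Real.exp (-t ^ 2)

/-- `φ(t) = t - log t - 1`, for `t > 0`. -/
def phi (t : ℝ) : ℝ :=
  t - Real.log t - 1

/-- The variable `η` of the uniform expansion: `η² / 2 = φ(l)`, where the square root has the
sign of `l - 1` (so that `η` is a smooth increasing function of `l > 0`). -/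
def eta (l : ℝ) : ℝ :=
  Real.sign (l - 1) * √(2 * phi l)

/-- The functions `C n` are the coefficients of Temme's expansion
`Γ(a, x) / Γ(a) ∼ erfc (η √(a/2)) / 2 + e^{-aη²/2} / √(2πa) * ∑ₙ C n η / aⁿ`
as `a → +∞`, with `x = l a` and `η = eta l`, uniformly in `l > 0`: for every `N`, the remainder
after the terms with `n < N` is `e^{-aη²/2} / √(2πa) * O(a^{-N})`, with an implied constant that
does not depend on `l`. -/
def IsUniformExpansion (C : ℕ → ℝ → ℝ) : Prop :=
  ∀ N : ℕ, ∃ K : ℝ, ∀ᶠ a : ℝ in Filter.atTop, ∀ l : ℝ, 0 < l →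
    |incompleteGamma a (l * a) / Real.Gamma a
        - (1 / 2 * erfc (eta l * √(1 / 2 * a))
          + Real.exp (-(1 / 2) * a * eta l ^ 2) / √(2 * Real.pi * a)
            * ∑ n ∈ Finset.range N, C n (eta l) / a ^ n)|
      ≤ K * (Real.exp (-(1 / 2) * a * eta l ^ 2) / √(2 * Real.pi * a) / a ^ N)

/-- The polynomials `Q n` are those in the representation of the coefficients `C n (η)`:
`C n η = (-1)ⁿ (Q n (μ) / μ^{2n+1} - 2ⁿ Γ(n + 1/2) / (√π η^{2n+1}))`, where `μ = l - 1`,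
for all `l ≠ 1`, that is, `η ≠ 0`. -/
def IsPolynomialPart (C : ℕ → ℝ → ℝ) (Q : ℕ → Polynomial ℝ) : Prop :=
  ∀ (n : ℕ) (l : ℝ), 0 < l → l ≠ 1 →
    C n (eta l) =
      (-1) ^ n * ((Q n).eval (l - 1) / (l - 1) ^ (2 * n + 1)
        - 2 ^ n * Real.Gamma (n + 1 / 2) / (√Real.pi * eta l ^ (2 * n + 1)))

end Temme

end

/-!
Write `G(μ) = η² / μ²`. This function is analytic at `μ = 0` with `G(0) = 1` (`ratio`), and
`(2n - 1)!! η^{-2n-1} = μ^{-2n-1} h_n(μ)` with `h_n = (2n - 1)!! G^{-(n + 1/2)}` (`singularPart`).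
Let `Q n` be the Taylor polynomial of `h_n` of degree `2n` (`polyPart`), and let `C n` be
`(-1)ⁿ (Q n / μ^{2n+1} - (2n - 1)!! / η^{2n+1})`. Up to the sign, `C n` is the Taylor remainder of
`h_n` divided by `μ^{2n+1}`, so it extends continuously across `μ = 0` (`coefFun`).

*The coefficients.* The `k`-th Taylor coefficient of `Gˣ` is a polynomial in `x` of degree at most
`k` (`exists_polynomial_coeff_of_ode`), hence its value at `x = -(n + 1/2)` is given by Lagrange
interpolation from the values at `x = 0, …, k` (`coeff_ratioPow_neg`). For a natural number `j`, the
coefficients of `Gʲ = 2ʲ (μ - log (1 + μ))ʲ / μ^{2j}` are expressed through those of the powers of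
`log (1 + μ)`, that is, through Stirling numbers (`coeff_pow_eq_sum_stirling`).

*The expansion.* Differentiating `η^{-2n-1}` gives a recurrence for `h_n` (`singularSeries_succ`),
therefore one for `Q n` (`polyPart_succ`), and finally `l (dC n / dl) = μ C (n+1) - γ (n+1)` with
constants `γ n` (`hasDerivAt_coefFun`). Because of it, the derivative in `l` of the remainder
`ρ_N(l)` of the expansion after `N` terms collapses (`hasDerivAt_remainder`) to
`-√(a/2π) (e^{-aφ(l)} / l) (δ + μ C N / a^N)`, where `δ` depends on `a` only: it is the error of the
Stirling series `∑ γ n / aⁿ`. For `N ≥ 1` the function `μ C N` is bounded on `(0, ∞)`. Since `ρ_N`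
vanishes at both ends of `(0, ∞)`, its derivative cannot have a constant sign, so `δ = O(a^{-N})`
(`abs_le_of_vanishing_ends`); no separate proof of Stirling's series is needed. Comparing `ρ_N` with
`e^{-aφ} (1 + 1/l)` on `[1, ∞)` and with `e^{-aφ} (1 + l)` on `(0, 1]` bounds it by a multiple of
`a^{1/2-N} e^{-aφ}` (`abs_le_exp_of_abs_deriv_le`). This is a factor `a` short of the claim, which is
made up for by using one more term of the expansion.

*Uniqueness.* At a fixed `l` the coefficients of an asymptotic expansion are unique, and a
polynomial is determined by its values at infinitely many points.
-/

noncomputable section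

/-! ### Taylor series of real functions -/

namespace Temme

open Filter Topology PowerSeries Function

/-- The Taylor series at `0` of a real function. -/
def taylorSeries (f : ℝ → ℝ) : PowerSeries ℝ :=
  PowerSeries.mk fun n => iteratedDeriv n f 0 / n !

lemma coeff_taylorSeries (f : ℝ → ℝ) (n : ℕ) :
    coeff n (taylorSeries f) = iteratedDeriv n f 0 / n ! := coeff_mk _ _

lemma constantCoeff_taylorSeries (f : ℝ → ℝ) : constantCoeff (taylorSeries f) = f 0 := by
  rw [← coeff_zero_eq_constantCoeff_apply, coeff_taylorSeries]; simp

lemma taylorSeries_congr {f g : ℝ → ℝ} (h : f =ᶠ[𝓝 0] g) : taylorSeries f = taylorSeries g := by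
  ext n
  rw [coeff_taylorSeries, coeff_taylorSeries, h.iteratedDeriv_eq]

lemma taylorSeries_mul {f g : ℝ → ℝ} (hf : AnalyticAt ℝ f 0) (hg : AnalyticAt ℝ g 0) :
    taylorSeries (fun x => f x * g x) = taylorSeries f * taylorSeries g := by
  ext n
  have h := iteratedDeriv_mul (n := n) hf.contDiffAt hg.contDiffAt
  rw [coeff_taylorSeries, PowerSeries.coeff_mul,
    Finset.Nat.sum_antidiagonal_eq_sum_range_succ_mk]
  change iteratedDeriv n (f * g) 0 / _ = _
  rw [h, Finset.sum_div]
  refine Finset.sum_congr rfl fun i hi => ?_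
  have hi' : i ≤ n := Nat.lt_succ_iff.mp (Finset.mem_range.mp hi)
  simp only [coeff_taylorSeries]
  rw [Nat.cast_choose ℝ hi']
  have h1 : (n ! : ℝ) ≠ 0 := by positivity
  have h2 : (i ! : ℝ) ≠ 0 := by positivity
  have h3 : ((n - i)! : ℝ) ≠ 0 := by positivity
  field_simp

lemma taylorSeries_deriv (f : ℝ → ℝ) :
    taylorSeries (deriv f) = derivative ℝ (taylorSeries f) := by
  ext n
  rw [coeff_taylorSeries, coeff_derivative, coeff_taylorSeries, iteratedDeriv_succ',
    Nat.factorial_succ]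
  have h1 : (n ! : ℝ) ≠ 0 := by positivity
  push_cast
  field_simp

lemma taylorSeries_const_mul (c : ℝ) (f : ℝ → ℝ) :
    taylorSeries (fun x => c * f x) = C c * taylorSeries f := by
  ext n
  rw [coeff_C_mul, coeff_taylorSeries, coeff_taylorSeries, iteratedDeriv_const_mul_field]
  ring

lemma taylorSeries_sub {f g : ℝ → ℝ} (hf : AnalyticAt ℝ f 0) (hg : AnalyticAt ℝ g 0) :
    taylorSeries (fun x => f x - g x) = taylorSeries f - taylorSeries g := by
  ext n
  rw [map_sub, coeff_taylorSeries, coeff_taylorSeries, coeff_taylorSeries, ← sub_div]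
  congr 1
  exact iteratedDeriv_sub hf.contDiffAt hg.contDiffAt

lemma taylorSeries_const (c : ℝ) : taylorSeries (fun _ => c) = C c := by
  ext n
  rw [coeff_taylorSeries, iteratedDeriv_const, coeff_C]
  split_ifs with h <;> simp [h]

lemma taylorSeries_id : taylorSeries (fun x => x) = X := by
  ext n
  rw [coeff_X]
  rcases n with _ | n
  · rw [coeff_taylorSeries]; simp
  · have h := congrArg (coeff n) (taylorSeries_deriv (fun x => x))
    have hd : deriv (fun x : ℝ => x) = fun _ => 1 := by ext x; simp
    rw [hd, taylorSeries_const, coeff_derivative, coeff_C] at h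
    rcases n with _ | n
    · simpa using h.symm
    · have : (n : ℝ) + 1 + 1 ≠ 0 := by positivity
      simpa [this] using h.symm

/-- The iterated divided differences of an analytic function at `0` are its Taylor
coefficients. -/
lemma iterate_dslope_eq_coeff {f : ℝ → ℝ} (hf : AnalyticAt ℝ f 0) (k : ℕ) :
    (swap dslope 0)^[k] f 0 = coeff k (taylorSeries f) := by
  have hp := hf.hasFPowerSeriesAt
  have h := (hp.has_fpower_series_iterate_dslope_fslope k).coeff_zero 1
  rw [← h, ← FormalMultilinearSeries.coeff, FormalMultilinearSeries.coeff_iterate_fslope,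
    coeff_taylorSeries]
  simp [FormalMultilinearSeries.coeff_ofScalars]

lemma analyticAt_iterate_dslope {f : ℝ → ℝ} (hf : AnalyticAt ℝ f 0) (k : ℕ) :
    AnalyticAt ℝ ((swap dslope 0)^[k] f) 0 :=
  ⟨_, hf.hasFPowerSeriesAt.has_fpower_series_iterate_dslope_fslope k⟩

/-- Taylor's formula with the remainder written as an iterated divided difference. -/
lemma eq_sum_add_pow_mul_iterate_dslope (f : ℝ → ℝ) (m : ℕ) (x : ℝ) :
    f x = ∑ k ∈ Finset.range m, (swap dslope 0)^[k] f 0 * x ^ k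
      + x ^ m * (swap dslope 0)^[m] f x := by
  induction m with
  | zero => simp
  | succ m ih =>
    have h := sub_smul_dslope ((swap dslope 0)^[m] f) 0 x
    rw [Finset.sum_range_succ, Function.iterate_succ', Function.comp_apply, swap]
    rw [sub_zero, smul_eq_mul] at h
    rw [ih, pow_succ, mul_assoc, h]
    ring

end Temme

/-! ### Powers of power series, interpolation and Stirling numbers -/

namespace Temme

open Filter Topology PowerSeries Function

/-- If `g` has constant coefficient `1`, the coefficients of the power `gˣ`, characterised by the
differential equation `g u' = x g' u` and `u(0) = 1`, are polynomials in the exponent `x`. -/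
lemma exists_polynomial_coeff_of_ode {g : PowerSeries ℝ} (hg : constantCoeff g = 1) (k : ℕ) :
    ∃ U : Polynomial ℝ, U.natDegree ≤ k ∧ ∀ (x : ℝ) (u : PowerSeries ℝ), constantCoeff u = 1 →
      g * derivative ℝ u = C x * (derivative ℝ g * u) → coeff k u = U.eval x := by
  induction k using Nat.strong_induction_on with
  | _ k ih =>
  rcases k with _ | k
  · exact ⟨1, by simp, fun x u hu _ => by simpa using hu⟩
  choose! V hV using ih
  let A : Polynomial ℝ := ∑ b ∈ Finset.range (k + 1),
    Polynomial.C (coeff (k - b + 1) g * ((k - b : ℕ) + 1)) * V b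
  let B : Polynomial ℝ := ∑ b ∈ Finset.range k,
    Polynomial.C (coeff (k - b) g * ((b : ℝ) + 1)) * V (b + 1)
  refine ⟨Polynomial.C ((k : ℝ) + 1)⁻¹ * (Polynomial.X * A - B), ?_, ?_⟩
  · refine (Polynomial.natDegree_C_mul_le _ _).trans ?_
    refine (Polynomial.natDegree_sub_le _ _).trans (max_le ?_ ?_)
    · refine Polynomial.natDegree_mul_le.trans ?_
      rw [Polynomial.natDegree_X, add_comm]
      gcongr
      refine Polynomial.natDegree_sum_le_of_forall_le _ _ fun b hb => ?_
      have hb' : b ≤ k := Nat.lt_succ_iff.mp (Finset.mem_range.mp hb)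
      exact (Polynomial.natDegree_C_mul_le _ _).trans ((hV b (by omega)).1.trans hb')
    · refine Polynomial.natDegree_sum_le_of_forall_le _ _ fun b hb => ?_
      have hb' : b < k := Finset.mem_range.mp hb
      exact (Polynomial.natDegree_C_mul_le _ _).trans ((hV (b + 1) (by omega)).1.trans (by omega))
  · intro x u hu hode
    have h := congrArg (coeff k) hode
    rw [coeff_C_mul, mul_comm g, PowerSeries.coeff_mul, mul_comm (derivative ℝ g) u,
      PowerSeries.coeff_mul,
      Finset.Nat.sum_antidiagonal_eq_sum_range_succ_mk,
      Finset.Nat.sum_antidiagonal_eq_sum_range_succ_mk, Finset.sum_range_succ] at h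
    simp only [coeff_derivative, Nat.sub_self, coeff_zero_eq_constantCoeff_apply, hg,
      mul_one] at h
    have hA : A.eval x = ∑ b ∈ Finset.range (k + 1),
        coeff b u * (coeff (k - b + 1) g * ((k - b : ℕ) + 1)) := by
      simp only [A, Polynomial.eval_finsetSum, Polynomial.eval_mul, Polynomial.eval_C]
      refine Finset.sum_congr rfl fun b hb => ?_
      have hb' : b ≤ k := Nat.lt_succ_iff.mp (Finset.mem_range.mp hb)
      rw [(hV b (by omega)).2 x u hu hode]
      ring
    have hB : B.eval x = ∑ b ∈ Finset.range k,
        coeff (b + 1) u * ((b : ℝ) + 1) * coeff (k - b) g := by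
      simp only [B, Polynomial.eval_finsetSum, Polynomial.eval_mul, Polynomial.eval_C]
      refine Finset.sum_congr rfl fun b hb => ?_
      have hb' : b < k := Finset.mem_range.mp hb
      rw [(hV (b + 1) (by omega)).2 x u hu hode]
      ring
    have hk : (k : ℝ) + 1 ≠ 0 := by positivity
    simp only [Polynomial.eval_mul, Polynomial.eval_C, Polynomial.eval_sub, Polynomial.eval_X]
    rw [hA, hB, ← h]
    field_simp
    ring

/-- Lagrange interpolation at the nodes `0, …, k`, evaluated at the point `-s`. -/
lemma eval_neg_eq_sum {U : Polynomial ℝ} {k : ℕ} (hU : U.natDegree ≤ k) {s : ℝ} (hs : 0 < s) :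
    U.eval (-s) = ∑ j ∈ Finset.range (k + 1), U.eval (j : ℝ) *
      ((-1) ^ j * (∏ i ∈ Finset.range (k + 1), (s + i)) / ((s + j) * (j ! * (k - j)!))) := by
  have hinj : Set.InjOn (fun i : ℕ => (i : ℝ)) (Finset.range (k + 1)) :=
    Nat.cast_injective.injOn
  have hdeg : U.degree < (Finset.range (k + 1)).card := by
    rw [Finset.card_range]
    exact (Polynomial.degree_le_natDegree).trans_lt (by exact_mod_cast Nat.lt_succ_of_le hU)
  conv_lhs => rw [Lagrange.eq_interpolate hinj hdeg]
  rw [Lagrange.interpolate_apply, Polynomial.eval_finsetSum]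
  refine Finset.sum_congr rfl fun j hj => ?_
  have hj' : j ≤ k := Nat.lt_succ_iff.mp (Finset.mem_range.mp hj)
  rw [Polynomial.eval_mul, Polynomial.eval_C]
  congr 1
  have hsj : s + j ≠ 0 := by positivity
  have hden : ∏ i ∈ (Finset.range (k + 1)).erase j, ((j : ℝ) - i) =
      j ! * ((-1) ^ (k - j) * (k - j)!) := by
    have : (Finset.range (k + 1)).erase j = Finset.range j ∪ Finset.Ico (j + 1) (k + 1) := by
      ext i; simp; omega
    rw [this, Finset.prod_union (Finset.disjoint_left.mpr fun i hi hi' => by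
      simp at hi hi'; omega)]
    congr 1
    · rw [← Finset.prod_range_reflect, ← Finset.prod_range_add_one_eq_factorial, Nat.cast_prod]
      refine Finset.prod_congr rfl fun i hi => ?_
      have := Finset.mem_range.mp hi
      rw [Nat.sub_sub, Nat.cast_sub (by omega)]
      push_cast; ring
    · rw [Finset.prod_Ico_eq_prod_range, Nat.add_sub_add_right,
        ← Finset.prod_range_add_one_eq_factorial, Nat.cast_prod]
      conv_rhs => rw [← Finset.card_range (k - j), ← Finset.prod_const, Finset.card_range,
        ← Finset.prod_mul_distrib]
      refine Finset.prod_congr rfl fun i hi => ?_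
      push_cast; ring
  have hnum : ∏ i ∈ (Finset.range (k + 1)).erase j, (-s - (i : ℝ)) =
      (-1) ^ k * ((∏ i ∈ Finset.range (k + 1), (s + i)) / (s + j)) := by
    rw [← Finset.mul_prod_erase _ _ hj, mul_div_cancel_left₀ _ hsj]
    have hc : ((Finset.range (k + 1)).erase j).card = k := by
      rw [Finset.card_erase_of_mem hj, Finset.card_range, Nat.add_sub_cancel]
    have hc' : (-1 : ℝ) ^ k = ∏ _i ∈ (Finset.range (k + 1)).erase j, (-1 : ℝ) := by
      rw [Finset.prod_const, hc]
    rw [hc', ← Finset.prod_mul_distrib]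
    exact Finset.prod_congr rfl fun i _ => by ring
  have hbasis : (Lagrange.basis (Finset.range (k + 1)) (fun i : ℕ => (i : ℝ)) j).eval (-s) =
      (∏ i ∈ (Finset.range (k + 1)).erase j, (-s - (i : ℝ))) /
        ∏ i ∈ (Finset.range (k + 1)).erase j, ((j : ℝ) - i) := by
    rw [Lagrange.basis, Polynomial.eval_prod, ← Finset.prod_div_distrib]
    refine Finset.prod_congr rfl fun i _ => ?_
    simp [Lagrange.basisDivisor, div_eq_inv_mul]
  rw [hbasis, hnum, hden]
  have h1 : (-1 : ℝ) ^ k = (-1) ^ j * (-1) ^ (k - j) := by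
    rw [← pow_add, Nat.add_sub_cancel' hj']
  have h2 : (-1 : ℝ) ^ (k - j) ≠ 0 := pow_ne_zero _ (by norm_num)
  rw [h1]
  field_simp

/-- The powers of the logarithmic series `L`, characterised by `(1 + X) L' = 1` and `L(0) = 0`,
generate the signless Stirling numbers of the first kind. -/
lemma coeff_pow_log {L : PowerSeries ℝ} (h0 : constantCoeff L = 0)
    (hL : (1 + X) * derivative ℝ L = 1) (i m : ℕ) :
    coeff m (L ^ i) = (-1) ^ (m + i) * (i ! * Nat.stirlingFirst m i / m !) := by
  induction i generalizing m with
  | zero =>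
    rcases m with _ | m
    · simp
    · simp [coeff_one]
  | succ i ihi =>
    induction m with
    | zero => simp [h0]
    | succ m ihm =>
      have hd : (1 + X) * derivative ℝ (L ^ (i + 1)) = C ((i : ℝ) + 1) * L ^ i := by
        rw [Derivation.leibniz_pow]
        simp only [smul_eq_mul, nsmul_eq_mul, Nat.add_sub_cancel]
        rw [show (1 + X) * (((i + 1 : ℕ) : PowerSeries ℝ) * (L ^ i * derivative ℝ L)) =
          ((i + 1 : ℕ) : PowerSeries ℝ) * L ^ i * ((1 + X) * derivative ℝ L) by ring, hL, mul_one]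
        congr 1
        push_cast
        simp
      have h := congrArg (coeff m) hd
      rw [coeff_C_mul, ihi, add_mul, one_mul, map_add, coeff_derivative] at h
      have hx : coeff m (X * derivative ℝ (L ^ (i + 1))) = m * coeff m (L ^ (i + 1)) := by
        rcases m with _ | m
        · simp
        · rw [coeff_succ_X_mul, coeff_derivative]; push_cast; ring
      rw [hx, ihm] at h
      have hm : (m : ℝ) + 1 ≠ 0 := by positivity
      have e : coeff (m + 1) (L ^ (i + 1)) =
          (((i : ℝ) + 1) * ((-1) ^ (m + i) * (i ! * Nat.stirlingFirst m i / m !)) -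
          m * ((-1) ^ (m + (i + 1)) * ((i + 1)! * Nat.stirlingFirst m (i + 1) / m !))) / (m + 1) := by
        rw [eq_div_iff hm]
        linarith
      rw [e, Nat.stirlingFirst_succ_succ, Nat.factorial_succ, Nat.factorial_succ]
      have hf : (m ! : ℝ) ≠ 0 := by positivity
      push_cast
      field_simp
      ring

/-- The coefficients of the powers `gʲ` of the series `g` with `X² g = 2 (X - L)`, where `L` is the
logarithmic series. -/
lemma coeff_pow_eq_sum_stirling {g L : PowerSeries ℝ} (h0 : constantCoeff L = 0)
    (hL : (1 + X) * derivative ℝ L = 1) (hg : X ^ 2 * g = C 2 * (X - L)) (j k : ℕ) :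
    coeff k (g ^ j) = 2 ^ j * j ! * (-1) ^ (k + j) * ∑ i ∈ Finset.range (j + 1),
      (-1 : ℝ) ^ i * (Nat.stirlingFirst (k + j + i) i : ℝ)
        / (((j - i)! : ℕ) * ((k + j + i)! : ℕ)) := by
  have h1 : coeff k (g ^ j) = coeff (k + 2 * j) (X ^ (2 * j) * g ^ j) := by
    rw [coeff_X_pow_mul]
  rw [h1, pow_mul, ← mul_pow, hg, mul_pow, ← map_pow, coeff_C_mul, sub_eq_neg_add, add_pow, map_sum,
    Finset.mul_sum, Finset.mul_sum]
  refine Finset.sum_congr rfl fun i hi => ?_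
  have hi' : i ≤ j := Nat.lt_succ_iff.mp (Finset.mem_range.mp hi)
  have h2 : (-L) ^ i * X ^ (j - i) * ((j.choose i : ℕ) : PowerSeries ℝ) =
      C ((-1) ^ i * (j.choose i : ℝ)) * (X ^ (j - i) * L ^ i) := by
    rw [neg_pow]
    simp only [map_mul, map_pow, map_neg, map_one, map_natCast]
    ring
  rw [h2, coeff_C_mul, show k + 2 * j = (k + j + i) + (j - i) by omega, coeff_X_pow_mul,
    coeff_pow_log h0 hL, Nat.cast_choose ℝ hi']
  have e1 : (-1 : ℝ) ^ (k + j + i + i) = (-1) ^ (k + j) := by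
    rw [add_assoc (k + j), ← two_mul, pow_add, pow_mul]; simp
  have f1 : (i ! : ℝ) ≠ 0 := by positivity
  rw [e1]
  field_simp

end Temme

/-! ### The functions `φ` and `η` -/

namespace Temme

open Filter Topology PowerSeries Function

lemma phi_nonneg {l : ℝ} (hl : 0 < l) : 0 ≤ phi l := by
  have := Real.log_le_sub_one_of_pos hl
  unfold phi; linarith

lemma phi_pos {l : ℝ} (hl : 0 < l) (h1 : l ≠ 1) : 0 < phi l := by
  have := Real.log_lt_sub_one_of_pos hl h1
  unfold phi; linarith

lemma phi_one : phi 1 = 0 := by simp [phi]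

lemma hasDerivAt_phi {l : ℝ} (hl : 0 < l) : HasDerivAt phi ((l - 1) / l) l := by
  have h := ((hasDerivAt_id l).sub (Real.hasDerivAt_log hl.ne')).sub_const 1
  refine h.congr_deriv ?_
  field_simp

lemma eta_sq {l : ℝ} (hl : 0 < l) : eta l ^ 2 = 2 * phi l := by
  have h0 : 0 ≤ 2 * phi l := by have := phi_nonneg hl; positivity
  rcases lt_trichotomy l 1 with h | rfl | h
  · rw [eta, Real.sign_of_neg (sub_neg.mpr h), mul_pow, Real.sq_sqrt h0]; ring
  · simp [eta, phi_one]
  · rw [eta, Real.sign_of_pos (sub_pos.mpr h), mul_pow, Real.sq_sqrt h0]; ring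

lemma eta_of_one_lt {l : ℝ} (h : 1 < l) : eta l = √(2 * phi l) := by
  simp [eta, Real.sign_of_pos (sub_pos.mpr h)]

lemma eta_of_lt_one {l : ℝ} (h : l < 1) : eta l = -√(2 * phi l) := by
  simp [eta, Real.sign_of_neg (sub_neg.mpr h)]

lemma eta_ne_zero {l : ℝ} (hl : 0 < l) (h1 : l ≠ 1) : eta l ≠ 0 := by
  intro h
  have h2 := eta_sq hl
  have h3 := phi_pos hl h1
  rw [h] at h2
  linarith

/-- The variables `μ = l - 1` and `η` have the same sign. -/
lemma sub_one_div_eta_pos {l : ℝ} (hl : 0 < l) (h1 : l ≠ 1) : 0 < (l - 1) / eta l := by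
  have h3 : 0 < √(2 * phi l) := Real.sqrt_pos.mpr (by have := phi_pos hl h1; positivity)
  rcases lt_or_gt_of_ne h1 with h | h
  · rw [eta_of_lt_one h]
    exact div_pos_of_neg_of_neg (by linarith) (by linarith)
  · rw [eta_of_one_lt h]
    exact div_pos (by linarith) h3

lemma hasDerivAt_eta {l : ℝ} (hl : 0 < l) (h1 : l ≠ 1) :
    HasDerivAt eta ((l - 1) / (l * eta l)) l := by
  have hp := phi_pos hl h1
  have h := ((hasDerivAt_phi hl).const_mul 2).sqrt (by positivity)
  have hs : √(2 * phi l) ≠ 0 := (Real.sqrt_pos.mpr (by positivity)).ne'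
  rcases lt_or_gt_of_ne h1 with h' | h'
  · have he : eta =ᶠ[𝓝 l] fun x => -√(2 * phi x) := by
      filter_upwards [Iio_mem_nhds h'] with x hx using eta_of_lt_one hx
    refine (h.neg.congr_of_eventuallyEq he).congr_deriv ?_
    rw [eta_of_lt_one h']
    field_simp
  · have he : eta =ᶠ[𝓝 l] fun x => √(2 * phi x) := by
      filter_upwards [Ioi_mem_nhds h'] with x hx using eta_of_one_lt hx
    refine (h.congr_of_eventuallyEq he).congr_deriv ?_
    rw [eta_of_one_lt h']
    field_simp

lemma abs_eta {l : ℝ} (hl : 0 < l) : |eta l| = √(2 * phi l) := by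
  rw [← eta_sq hl, Real.sqrt_sq_eq_abs]

lemma eta_one : eta 1 = 0 := by simp [eta]

lemma continuousAt_eta {l : ℝ} (hl : 0 < l) : ContinuousAt eta l := by
  by_cases h1 : l = 1
  · subst h1
    rw [ContinuousAt, eta_one]
    have h : Tendsto (fun x => √(2 * phi x)) (𝓝 1) (𝓝 0) := by
      have : ContinuousAt (fun x => √(2 * phi x)) 1 :=
        ((hasDerivAt_phi one_pos).continuousAt.const_mul 2).sqrt
      simpa [ContinuousAt, phi_one] using this
    refine squeeze_zero_norm' ?_ h
    filter_upwards [Ioi_mem_nhds one_pos] with x hx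
    rw [Real.norm_eq_abs, abs_eta hx]
  · exact (hasDerivAt_eta hl h1).continuousAt

lemma strictMonoOn_phi : StrictMonoOn phi (Set.Ici 1) := by
  refine strictMonoOn_of_deriv_pos (convex_Ici 1) ?_ ?_
  · exact fun x hx => (hasDerivAt_phi (one_pos.trans_le hx)).continuousAt.continuousWithinAt
  · intro x hx
    rw [interior_Ici] at hx
    have hx' : (1 : ℝ) < x := hx
    rw [(hasDerivAt_phi (by linarith)).deriv]
    exact div_pos (by linarith) (by linarith)

lemma strictAntiOn_phi : StrictAntiOn phi (Set.Ioc 0 1) := by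
  refine strictAntiOn_of_deriv_neg (convex_Ioc 0 1) ?_ ?_
  · exact fun x hx => (hasDerivAt_phi hx.1).continuousAt.continuousWithinAt
  · intro x hx
    rw [interior_Ioc] at hx
    rw [(hasDerivAt_phi hx.1).deriv]
    exact div_neg_of_neg_of_pos (by linarith [hx.2]) hx.1

lemma injOn_eta : Set.InjOn eta (Set.Ioi 0) := by
  intro x hx y hy h
  have hx' : 0 < x := hx
  have hy' : 0 < y := hy
  have hp : phi x = phi y := by
    have h1 := eta_sq hx'
    have h2 := eta_sq hy'
    rw [h] at h1; linarith
  by_cases h1 : x = 1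
  · subst h1
    by_contra hne
    exact eta_ne_zero hy' (Ne.symm hne) (by rw [← h, eta_one])
  by_cases h2 : y = 1
  · subst h2
    exact absurd (by rw [h, eta_one]) (eta_ne_zero hx' h1)
  have hpx := sub_one_div_eta_pos hx' h1
  have hpy := sub_one_div_eta_pos hy' h2
  rw [h] at hpx
  have hprod : 0 < (x - 1) * (y - 1) := by
    have h3 := mul_pos hpx hpy
    have h4 : 0 < eta y ^ 2 := by have := eta_ne_zero hy' h2; positivity
    have h5 : (x - 1) * (y - 1) = (x - 1) / eta y * ((y - 1) / eta y) * eta y ^ 2 := by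
      have := eta_ne_zero hy' h2
      field_simp
    rw [h5]; positivity
  rcases lt_or_gt_of_ne h1 with h3 | h3
  · have : y < 1 := by nlinarith
    exact strictAntiOn_phi.injOn ⟨hx', h3.le⟩ ⟨hy', this.le⟩ hp
  · have : 1 < y := by nlinarith
    exact strictMonoOn_phi.injOn (Set.mem_Ici.mpr h3.le) (Set.mem_Ici.mpr this.le) hp

/-- A linear lower bound of `φ`, from `log (l / 2) ≤ l / 2 - 1`. -/
lemma phi_ge (l : ℝ) (hl : 0 < l) : l / 2 - Real.log 2 ≤ phi l := by
  have h := Real.log_le_sub_one_of_pos (half_pos hl)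
  rw [Real.log_div hl.ne' two_ne_zero] at h
  unfold phi; linarith

lemma tendsto_phi_atTop : Tendsto phi atTop atTop := by
  refine tendsto_atTop_mono' _ ((eventually_gt_atTop 0).mono phi_ge) ?_
  exact tendsto_atTop_add_const_right _ _ (tendsto_id.atTop_div_const two_pos)

lemma tendsto_phi_zero : Tendsto phi (𝓝[>] 0) atTop := by
  have h : Tendsto (fun l => -Real.log l + -1) (𝓝[>] 0) atTop :=
    tendsto_atTop_add_const_right _ _ (tendsto_neg_atBot_atTop.comp Real.tendsto_log_nhdsGT_zero)
  refine tendsto_atTop_mono' _ ?_ h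
  filter_upwards [self_mem_nhdsWithin] with l hl
  have : (0 : ℝ) < l := hl
  unfold phi; linarith

lemma tendsto_eta_atTop : Tendsto eta atTop atTop := by
  have h : Tendsto (fun l => √(2 * phi l)) atTop atTop :=
    Real.tendsto_sqrt_atTop.comp (tendsto_phi_atTop.const_mul_atTop two_pos)
  refine h.congr' ?_
  filter_upwards [eventually_gt_atTop 1] with l hl using (eta_of_one_lt hl).symm

lemma tendsto_eta_zero : Tendsto eta (𝓝[>] 0) atBot := by
  have h : Tendsto (fun l => -√(2 * phi l)) (𝓝[>] 0) atBot :=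
    tendsto_neg_atTop_atBot.comp
      (Real.tendsto_sqrt_atTop.comp (tendsto_phi_zero.const_mul_atTop two_pos))
  refine h.congr' ?_
  filter_upwards [Ioo_mem_nhdsGT one_pos] with l hl using (eta_of_lt_one hl.2).symm

/-! ### The ratio of `η²` to `μ²` -/

/-- The function `μ - log (1 + μ)`, which is `φ(1 + μ) = η² / 2`. -/
def phiShift (x : ℝ) : ℝ := x - Real.log (1 + x)

/-- The function `η² / μ²` of `μ`, extended analytically across `μ = 0`. -/
def ratio (x : ℝ) : ℝ := 2 * (swap dslope 0)^[2] phiShift x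

lemma analyticAt_log_one_add : AnalyticAt ℝ (fun x : ℝ => Real.log (1 + x)) 0 :=
  AnalyticAt.log (analyticAt_const.add analyticAt_id) (by simp)

lemma analyticAt_phiShift : AnalyticAt ℝ phiShift 0 := analyticAt_id.sub analyticAt_log_one_add

lemma analyticAt_ratio : AnalyticAt ℝ ratio 0 :=
  analyticAt_const.mul (analyticAt_iterate_dslope analyticAt_phiShift 2)

/-- Both Taylor coefficients which the double divided difference removes from `μ - log (1 + μ)`
vanish. -/
lemma sq_mul_ratio (x : ℝ) : x ^ 2 * ratio x = 2 * phiShift x := by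
  have h := eq_sum_add_pow_mul_iterate_dslope phiShift 2 x
  have hd : HasDerivAt phiShift (1 - 1) 0 := by
    have := ((hasDerivAt_id (0 : ℝ)).const_add 1).log (by simp)
    exact ((hasDerivAt_id (0 : ℝ)).sub this).congr_deriv (by simp)
  have hd' : deriv phiShift 0 = 0 := by rw [hd.deriv]; simp
  have h0 : phiShift 0 = 0 := by simp [phiShift]
  have hs : (∑ k ∈ Finset.range 2, (swap dslope 0)^[k] phiShift 0 * x ^ k) = 0 := by
    simp [Finset.sum_range_succ, h0, swap, hd']
  rw [hs, zero_add] at h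
  rw [ratio, h]; ring

/-- The Taylor series of `log (1 + x)`. -/
def logSeries : PowerSeries ℝ := taylorSeries fun x => Real.log (1 + x)

lemma constantCoeff_logSeries : constantCoeff logSeries = 0 := by
  rw [logSeries, constantCoeff_taylorSeries]; simp

lemma one_add_X_mul_derivative_logSeries : (1 + X) * derivative ℝ logSeries = 1 := by
  have hX : (1 + X : PowerSeries ℝ) = taylorSeries fun x => 1 + x := by
    have h := taylorSeries_sub (f := fun x => x) (g := fun _ => -1) analyticAt_id analyticAt_const
    rw [taylorSeries_id, taylorSeries_const] at h
    simp only [sub_neg_eq_add] at h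
    simp_rw [add_comm (1 : ℝ), h]
    simp [add_comm]
  have hax : AnalyticAt ℝ (fun x : ℝ => 1 + x) 0 := analyticAt_const.add analyticAt_id
  rw [logSeries, ← taylorSeries_deriv, hX,
    ← taylorSeries_mul hax analyticAt_log_one_add.deriv,
    ← map_one (C (R := ℝ)), ← taylorSeries_const]
  refine taylorSeries_congr ?_
  filter_upwards [Ioi_mem_nhds (show (-1 : ℝ) < 0 by norm_num)] with x hx
  have hx' : 1 + x ≠ 0 := by have : -1 < x := hx; linarith
  have h : HasDerivAt (fun y : ℝ => Real.log (1 + y)) (1 / (1 + x)) x :=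
    ((hasDerivAt_id x).const_add 1).log hx'
  rw [h.deriv]
  simp [hx']

/-- The Taylor series of `η² / μ²` in powers of `μ`. -/
def ratioSeries : PowerSeries ℝ := taylorSeries ratio

lemma X_sq_mul_ratioSeries : X ^ 2 * ratioSeries = C 2 * (X - logSeries) := by
  have hid : AnalyticAt ℝ (fun x : ℝ => x) 0 := analyticAt_id
  have hsq : AnalyticAt ℝ (fun x : ℝ => x * x) 0 := hid.mul hid
  have hX : (X ^ 2 : PowerSeries ℝ) = taylorSeries fun x => x * x := by
    rw [taylorSeries_mul hid hid, taylorSeries_id, sq]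
  rw [hX, ratioSeries, ← taylorSeries_mul hsq analyticAt_ratio,
    logSeries, ← taylorSeries_id, ← taylorSeries_sub hid analyticAt_log_one_add,
    ← taylorSeries_const_mul]
  congr 1
  ext x
  rw [← sq, sq_mul_ratio]; rfl

/-- The differential equation of the series `η² / μ²`. -/
lemma ratioSeries_ode :
    (1 + X) * (2 * ratioSeries + X * derivative ℝ ratioSeries) = 2 := by
  have h := congrArg (derivative ℝ) X_sq_mul_ratioSeries
  have hC : (C (2 : ℝ)) = (2 : PowerSeries ℝ) := map_ofNat C 2
  rw [Derivation.leibniz, Derivation.leibniz, derivative_C, map_sub, derivative_X,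
    Derivation.leibniz_pow, derivative_X, hC] at h
  simp only [smul_eq_mul, nsmul_eq_mul] at h
  have hl := one_add_X_mul_derivative_logSeries
  -- Differentiating `X² G = 2 (X - L)` gives the equation multiplied by `X`.
  refine mul_left_cancel₀ (X_ne_zero : (X : PowerSeries ℝ) ≠ 0) ?_
  push_cast at h
  linear_combination (1 + X) * h - 2 * hl

lemma constantCoeff_ratioSeries : constantCoeff ratioSeries = 1 := by
  have h := congrArg constantCoeff ratioSeries_ode
  simp only [map_mul, map_add, map_one, constantCoeff_X, map_ofNat] at h
  linarith

lemma ratio_zero : ratio 0 = 1 := by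
  rw [← constantCoeff_ratioSeries, ratioSeries, constantCoeff_taylorSeries]

/-- The real power `(η² / μ²)^s`, as a function of `μ` near `0`. -/
def ratioPow (s x : ℝ) : ℝ := Real.exp (s * Real.log (ratio x))

lemma eventually_ratio_pos : ∀ᶠ x in 𝓝 0, 0 < ratio x :=
  analyticAt_ratio.continuousAt.eventually (lt_mem_nhds (by rw [ratio_zero]; exact one_pos))

lemma analyticAt_ratioPow (s : ℝ) : AnalyticAt ℝ (ratioPow s) 0 :=
  (analyticAt_const.mul (analyticAt_ratio.log (by rw [ratio_zero]; exact one_pos))).rexp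

lemma constantCoeff_ratioPow (s : ℝ) : constantCoeff (taylorSeries (ratioPow s)) = 1 := by
  rw [constantCoeff_taylorSeries, ratioPow, ratio_zero]; simp

lemma ratioSeries_mul_ratioPow (s : ℝ) :
    ratioSeries * taylorSeries (ratioPow (s - 1)) = taylorSeries (ratioPow s) := by
  rw [ratioSeries, ← taylorSeries_mul analyticAt_ratio (analyticAt_ratioPow _)]
  refine taylorSeries_congr ?_
  filter_upwards [eventually_ratio_pos] with x hx
  rw [ratioPow, ratioPow, sub_mul, one_mul, Real.exp_sub, Real.exp_log hx]
  field_simp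

/-- The differential equation `G u' = s G' u` of the power `u = G^s` of the series `G`. -/
lemma ratioPow_ode (s : ℝ) :
    ratioSeries * derivative ℝ (taylorSeries (ratioPow s)) =
      C s * (derivative ℝ ratioSeries * taylorSeries (ratioPow s)) := by
  rw [ratioSeries, ← taylorSeries_deriv, ← taylorSeries_deriv,
    ← taylorSeries_mul analyticAt_ratio (analyticAt_ratioPow _).deriv,
    ← taylorSeries_mul analyticAt_ratio.deriv (analyticAt_ratioPow _), ← taylorSeries_const_mul]
  refine taylorSeries_congr ?_
  filter_upwards [eventually_ratio_pos, analyticAt_ratio.eventually_analyticAt] with x hx hax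
  have h := ((hax.differentiableAt.hasDerivAt.log hx.ne').const_mul s).exp
  have h' : deriv (ratioPow s) x = _ := h.deriv
  rw [h', ratioPow]
  field_simp

/-- The natural powers of `G` satisfy the equation which characterises the real powers. -/
lemma constantCoeff_ratioSeries_pow_ode (j : ℕ) : constantCoeff (ratioSeries ^ j) = 1 ∧
    ratioSeries * derivative ℝ (ratioSeries ^ j) =
      C (j : ℝ) * (derivative ℝ ratioSeries * ratioSeries ^ j) := by
  refine ⟨by rw [map_pow, constantCoeff_ratioSeries, one_pow], ?_⟩
  rw [Derivation.leibniz_pow]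
  rcases j with _ | j
  · simp
  · simp only [smul_eq_mul, nsmul_eq_mul, map_natCast, Nat.add_sub_cancel]
    ring

/-- The Taylor coefficients of a negative power of `G = η² / μ²`, by interpolation from those of the
powers with exponents `0, …, k`. -/
lemma coeff_ratioPow_neg {s : ℝ} (hs : 0 < s) (k : ℕ) :
    coeff k (taylorSeries (ratioPow (-s))) = ∑ j ∈ Finset.range (k + 1),
      coeff k (ratioSeries ^ j) *
      ((-1) ^ j * (∏ i ∈ Finset.range (k + 1), (s + i)) / ((s + j) * (j ! * (k - j)!))) := by
  obtain ⟨U, hU, h⟩ := exists_polynomial_coeff_of_ode constantCoeff_ratioSeries k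
  rw [h _ _ (constantCoeff_ratioPow (-s)) (ratioPow_ode (-s)), eval_neg_eq_sum hU hs]
  refine Finset.sum_congr rfl fun j _ => ?_
  obtain ⟨h1, h2⟩ := constantCoeff_ratioSeries_pow_ode j
  rw [h _ _ h1 h2]

/-! ### The Taylor series of `(2n - 1)!! (μ / η)^{2n+1}` -/

/-- The constant `2ⁿ Γ(n + 1/2) / √π = (2n - 1)!!`. -/
def oddFactorial (n : ℕ) : ℝ := 2 ^ n * Real.Gamma (n + 1 / 2) / √Real.pi

lemma oddFactorial_zero : oddFactorial 0 = 1 := by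
  have : √Real.pi ≠ 0 := (Real.sqrt_pos.mpr Real.pi_pos).ne'
  simp only [oddFactorial, pow_zero, Nat.cast_zero, zero_add, one_mul, Real.Gamma_one_half_eq]
  exact div_self this

lemma oddFactorial_succ (n : ℕ) : oddFactorial (n + 1) = (2 * n + 1) * oddFactorial n := by
  have h : ((n + 1 : ℕ) : ℝ) + 1 / 2 = (n + 1 / 2) + 1 := by push_cast; ring
  rw [oddFactorial, oddFactorial, h, Real.Gamma_add_one (by positivity)]
  ring

/-- The function `(2n - 1)!! (μ / η)^{2n+1}` of `μ`, analytic at `0`. -/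
def singularPart (n : ℕ) (x : ℝ) : ℝ := oddFactorial n * ratioPow (-(n + 1 / 2)) x

lemma analyticAt_singularPart (n : ℕ) : AnalyticAt ℝ (singularPart n) 0 :=
  analyticAt_const.mul (analyticAt_ratioPow _)

lemma singularPart_eq (n : ℕ) {l : ℝ} (hl : 0 < l) (h1 : l ≠ 1) :
    singularPart n (l - 1) = oddFactorial n * ((l - 1) / eta l) ^ (2 * n + 1) := by
  have hp := sub_one_div_eta_pos hl h1
  have hr : ratio (l - 1) = (((l - 1) / eta l) ^ 2)⁻¹ := by
    have h := sq_mul_ratio (l - 1)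
    have h2 : phiShift (l - 1) = phi l := by simp [phiShift, phi]; ring
    rw [h2, ← eta_sq hl] at h
    have h3 := sub_ne_zero.mpr h1
    have h4 := eta_ne_zero hl h1
    field_simp
    linarith
  rw [singularPart, ratioPow, hr, Real.log_inv, Real.log_pow]
  congr 1
  rw [← Real.exp_log (pow_pos hp (2 * n + 1)), Real.log_pow]
  congr 1
  push_cast
  ring

/-- The Taylor series of `(2n - 1)!! (μ / η)^{2n+1}`. -/
def singularSeries (n : ℕ) : PowerSeries ℝ := taylorSeries (singularPart n)

lemma singularSeries_eq (n : ℕ) : singularSeries n =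
    C (oddFactorial n) * taylorSeries (ratioPow (-(n + 1 / 2))) := taylorSeries_const_mul _ _

/-- The differentiation rule `(d/dη) η^{-2n-1} = -(2n+1) η^{-2n-2}`, written in powers of `μ`. -/
lemma singularSeries_succ (n : ℕ) : singularSeries (n + 1) =
    (1 + X) * (((2 * n + 1 : ℕ) : PowerSeries ℝ) * singularSeries n - X * derivative ℝ (singularSeries n)) := by
  set u := taylorSeries (ratioPow (-(n + 1 / 2))) with hu
  set v := taylorSeries (ratioPow (-(n + 1 / 2) - 1)) with hv
  have e : (-(((n + 1 : ℕ) : ℝ) + 1 / 2)) = -(n + 1 / 2) - 1 := by push_cast; ring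
  have hguv : ratioSeries * v = u := ratioSeries_mul_ratioPow _
  have hode : ratioSeries * derivative ℝ u = _ := ratioPow_ode (-(n + 1 / 2))
  rw [← hu] at hode
  have hg0 : ratioSeries ≠ 0 := fun h => by
    have := constantCoeff_ratioSeries
    rw [h] at this; simp at this
  have hode' : derivative ℝ u = C (-(n + 1 / 2) : ℝ) * (derivative ℝ ratioSeries * v) := by
    refine mul_left_cancel₀ hg0 ?_
    rw [hode, ← hguv]; ring
  have hc : (2 * C (-(n + 1 / 2) : ℝ) : PowerSeries ℝ) = -((2 * n + 1 : ℕ) : PowerSeries ℝ) := by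
    have h2 : (2 : PowerSeries ℝ) = C (2 : ℝ) := (map_ofNat C 2).symm
    have hN : ((2 * n + 1 : ℕ) : PowerSeries ℝ) = C ((2 * n + 1 : ℕ) : ℝ) := (map_natCast C _).symm
    rw [h2, hN, ← map_mul, ← map_neg]
    congr 1; push_cast; ring
  have hd : C (oddFactorial (n + 1)) = ((2 * n + 1 : ℕ) : PowerSeries ℝ) * C (oddFactorial n) := by
    rw [oddFactorial_succ, map_mul, ← map_natCast C]; push_cast; rfl
  rw [singularSeries_eq, singularSeries_eq, e, ← hu, ← hv, hd, Derivation.leibniz, derivative_C,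
    hode', ← hguv]
  simp only [smul_eq_mul, mul_zero, add_zero]
  have hr := ratioSeries_ode
  have h20 : (2 : PowerSeries ℝ) ≠ 0 := fun h => by
    have h' := congrArg constantCoeff h
    rw [map_ofNat, map_zero] at h'
    norm_num at h'
  refine mul_left_cancel₀ h20 ?_
  linear_combination (-((2 * n + 1 : ℕ) : PowerSeries ℝ) * C (oddFactorial n) * v) * hr
    - (-(1 + X) * X * C (oddFactorial n) * derivative ℝ ratioSeries * v) * hc

end Temme

/-! ### The coefficients of the expansion -/

namespace Temme

open Filter Topology PowerSeries Function Asymptotics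

/-- The polynomial `Q n`: the Taylor polynomial of degree `2n` of `(2n - 1)!! (μ / η)^{2n+1}`. -/
def polyPart (n : ℕ) : Polynomial ℝ := trunc (2 * n + 1) (singularSeries n)

lemma coeff_polyPart (n k : ℕ) :
    (polyPart n).coeff k = if k < 2 * n + 1 then coeff k (singularSeries n) else 0 :=
  coeff_trunc _ _ _

lemma natDegree_polyPart_le (n : ℕ) : (polyPart n).natDegree ≤ 2 * n :=
  Nat.lt_succ_iff.mp (natDegree_trunc_lt _ _)

/-- The coefficients of the polynomials `Q n` in terms of Stirling numbers: the product in the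
interpolation formula is the quotient `Γ(n + k + 3/2) / Γ(n + 1/2)`. -/
lemma coeff_polyPart_eq (n k : ℕ) (hk : k ≤ 2 * n) : (polyPart n).coeff k =
    ∑ j ∈ Finset.range (k + 1),
      (-1 : ℝ) ^ k * 2 ^ (n + j + 1) * Real.Gamma ((n : ℝ) + k + 3 / 2)
        / (√Real.pi * (2 * n + 2 * j + 1) * ((k - j)! : ℕ))
        * ∑ i ∈ Finset.range (j + 1),
            (-1 : ℝ) ^ i * (Nat.stirlingFirst (k + j + i) i : ℝ)
              / (((j - i)! : ℕ) * ((k + j + i)! : ℕ)) := by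
  have hs : (0 : ℝ) < n + 1 / 2 := by positivity
  have hG : ∀ m : ℕ, Real.Gamma ((n : ℝ) + 1 / 2) * ∏ i ∈ Finset.range m, ((n : ℝ) + 1 / 2 + i) =
      Real.Gamma ((n : ℝ) + 1 / 2 + m) := by
    intro m
    induction m with
    | zero => simp
    | succ m ih =>
      rw [Finset.prod_range_succ, ← mul_assoc, ih, mul_comm, ← Real.Gamma_add_one (by positivity)]
      congr 1; push_cast; ring
  have hGk : Real.Gamma ((n : ℝ) + k + 3 / 2) =
      Real.Gamma ((n : ℝ) + 1 / 2) * ∏ i ∈ Finset.range (k + 1), ((n : ℝ) + 1 / 2 + i) := by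
    rw [hG]; congr 1; push_cast; ring
  have hpi : √Real.pi ≠ 0 := (Real.sqrt_pos.mpr Real.pi_pos).ne'
  rw [coeff_polyPart, if_pos (by omega), singularSeries_eq, coeff_C_mul, coeff_ratioPow_neg hs,
    Finset.mul_sum]
  refine Finset.sum_congr rfl fun j hj => ?_
  rw [coeff_pow_eq_sum_stirling constantCoeff_logSeries one_add_X_mul_derivative_logSeries
    X_sq_mul_ratioSeries, hGk, oddFactorial]
  generalize ∑ i ∈ Finset.range (j + 1), (-1 : ℝ) ^ i * (Nat.stirlingFirst (k + j + i) i : ℝ)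
        / (((j - i)! : ℕ) * ((k + j + i)! : ℕ)) = S
  generalize ∏ i ∈ Finset.range (k + 1), ((n : ℝ) + 1 / 2 + i) = P
  have h1 : (n : ℝ) + 1 / 2 + j ≠ 0 := by positivity
  have h2 : (2 * n + 2 * j + 1 : ℝ) ≠ 0 := by positivity
  have h3 : (2 * n + 2 * j + 1 : ℝ) = 2 * ((n : ℝ) + 1 / 2 + j) := by ring
  have h4 : (-1 : ℝ) ^ (k + j) * (-1) ^ j = (-1) ^ k := by
    rw [← pow_add, add_assoc, ← two_mul, pow_add, pow_mul]; simp
  have h5 : (j ! : ℝ) ≠ 0 := by positivity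
  rw [h3, ← h4]
  field_simp
  ring

/-- The Stirling coefficients, read off from the leading coefficients of the polynomials `Q n`:
they are the coefficients of the expansion of `aᵃ e^{-a} √(2π/a) / Γ(a)` in powers of `1/a`. -/
def stirlingCoeff (n : ℕ) : ℝ := (-1) ^ n * coeff (2 * n) (singularSeries n)

lemma stirlingCoeff_zero : stirlingCoeff 0 = 1 := by
  rw [stirlingCoeff, singularSeries_eq, coeff_C_mul, oddFactorial_zero]
  simp [constantCoeff_ratioPow]

lemma polyPart_zero : polyPart 0 = 1 := by
  ext k
  rw [coeff_polyPart]
  rcases k with _ | k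
  · have := stirlingCoeff_zero
    simp [stirlingCoeff] at this
    simp [this]
  · simp [Polynomial.coeff_one]

/-- The recurrence of the polynomials `Q n`: it is the recurrence of the Taylor series, except for
the term of degree `2n + 2`, which the truncation of the previous series loses. -/
lemma polyPart_succ (n : ℕ) : polyPart (n + 1) =
    (1 + Polynomial.X) * (((2 * n + 1 : ℕ) : Polynomial ℝ) * polyPart n
        - Polynomial.X * Polynomial.derivative (polyPart n))
      + Polynomial.C ((-1) ^ (n + 1) * stirlingCoeff (n + 1)) * Polynomial.X ^ (2 * n + 2) := by
  have hp : ∀ k : ℕ, (((2 * n + 1 : ℕ) : Polynomial ℝ) * polyPart n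
      - Polynomial.X * Polynomial.derivative (polyPart n)).coeff k =
      ((2 * n + 1 : ℕ) - k : ℝ) * (polyPart n).coeff k := by
    intro k
    rw [Polynomial.coeff_sub, Polynomial.coeff_natCast_mul]
    rcases k with _ | k
    · simp
    · rw [Polynomial.coeff_X_mul, Polynomial.coeff_derivative]; push_cast; ring
  have hs : ∀ k : ℕ, coeff k (((2 * n + 1 : ℕ) : PowerSeries ℝ) * singularSeries n
      - X * derivative ℝ (singularSeries n)) =
      ((2 * n + 1 : ℕ) - k : ℝ) * coeff k (singularSeries n) := by
    intro k
    rw [map_sub, ← map_natCast (C (R := ℝ)), coeff_C_mul]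
    rcases k with _ | k
    · simp
    · rw [coeff_succ_X_mul, coeff_derivative]; push_cast; ring
  have hstir : (-1) ^ (n + 1) * stirlingCoeff (n + 1) =
      coeff (2 * n + 2) (singularSeries (n + 1)) := by
    rw [stirlingCoeff, ← mul_assoc, ← mul_pow]; simp [mul_add]
  have hz : ∀ k, 2 * n + 1 ≤ k → (polyPart n).coeff k = 0 := fun k hk => by
    rw [coeff_polyPart, if_neg (by omega)]
  -- The factor `2n + 1 - k` kills the first Taylor coefficient which `Q n` omits.
  have hlow : ∀ k, k ≤ 2 * n + 1 → ((2 * n + 1 : ℕ) - k : ℝ) * (polyPart n).coeff k =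
      ((2 * n + 1 : ℕ) - k : ℝ) * coeff k (singularSeries n) := by
    intro k hk
    rcases hk.lt_or_eq with h | rfl
    · rw [coeff_polyPart, if_pos h]
    · simp
  ext k
  rw [hstir, Polynomial.coeff_add, Polynomial.coeff_C_mul_X_pow, add_mul, one_mul,
    Polynomial.coeff_add, hp]
  rcases lt_trichotomy k (2 * n + 2) with hk | rfl | hk
  · rw [if_neg hk.ne, add_zero, coeff_polyPart, if_pos (by omega), singularSeries_succ,
      add_mul, one_mul, map_add, hs, hlow k (by omega)]
    congr 1
    rcases k with _ | k
    · simp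
    · rw [Polynomial.coeff_X_mul, coeff_succ_X_mul, hs, hp, hlow k (by omega)]
  · rw [if_pos rfl, Polynomial.coeff_X_mul, hp, hz (2 * n + 2) (by omega), hz (2 * n + 1) le_rfl,
      coeff_polyPart, if_pos (by omega)]
    simp
  · obtain ⟨m, rfl⟩ : ∃ m, k = m + 1 := ⟨k - 1, by omega⟩
    rw [if_neg hk.ne', Polynomial.coeff_X_mul, hp, hz _ (by omega), hz m (by omega),
      coeff_polyPart, if_neg (by omega)]
    simp

/-- The coefficient `C n`, as a function of `l`: up to the sign, the remainder of the Taylor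
polynomial `Q n`, divided by `μ^{2n+1}`. -/
def coefFun (n : ℕ) (l : ℝ) : ℝ :=
  (-1) ^ (n + 1) * (swap dslope 0)^[2 * n + 1] (singularPart n) (l - 1)

lemma coefFun_eq (n : ℕ) {l : ℝ} (hl : 0 < l) (h1 : l ≠ 1) : coefFun n l =
    (-1) ^ n * ((polyPart n).eval (l - 1) / (l - 1) ^ (2 * n + 1)
      - oddFactorial n / eta l ^ (2 * n + 1)) := by
  have h := eq_sum_add_pow_mul_iterate_dslope (singularPart n) (2 * n + 1) (l - 1)
  have hQ : (polyPart n).eval (l - 1) =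
      ∑ k ∈ Finset.range (2 * n + 1),
        (swap dslope 0)^[k] (singularPart n) 0 * (l - 1) ^ k := by
    rw [Polynomial.eval_eq_sum_range' (Nat.lt_succ_of_le (natDegree_polyPart_le n))]
    refine Finset.sum_congr rfl fun k hk => ?_
    rw [coeff_polyPart, if_pos (Finset.mem_range.mp hk),
      iterate_dslope_eq_coeff (analyticAt_singularPart n)]
    rfl
  rw [← hQ, singularPart_eq n hl h1, div_pow] at h
  have h3 : (l - 1) ^ (2 * n + 1) ≠ 0 := pow_ne_zero _ (sub_ne_zero.mpr h1)
  have h4 : eta l ^ (2 * n + 1) ≠ 0 := pow_ne_zero _ (eta_ne_zero hl h1)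
  have h5 : (polyPart n).eval (l - 1) = oddFactorial n * ((l - 1) ^ (2 * n + 1)
      / eta l ^ (2 * n + 1)) - (l - 1) ^ (2 * n + 1) *
        (swap dslope 0)^[2 * n + 1] (singularPart n) (l - 1) := by linarith
  rw [h5, coefFun]
  field_simp
  ring

/-- The recurrence of the coefficients: `λ (dC n / dλ) = μ C (n+1) - γ (n+1)`. -/
lemma hasDerivAt_coefFun (n : ℕ) {l : ℝ} (hl : 0 < l) (h1 : l ≠ 1) :
    HasDerivAt (coefFun n) (((l - 1) * coefFun (n + 1) l - stirlingCoeff (n + 1)) / l) l := by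
  have hm : l - 1 ≠ 0 := sub_ne_zero.mpr h1
  have he := eta_ne_zero hl h1
  have hev : coefFun n =ᶠ[𝓝 l] fun x =>
      (-1) ^ n * ((polyPart n).eval (x - 1) / (x - 1) ^ (2 * n + 1)
      - oddFactorial n / eta x ^ (2 * n + 1)) := by
    filter_upwards [Ioi_mem_nhds hl, isOpen_ne.mem_nhds h1] with x hx hx1
    exact coefFun_eq n hx hx1
  have hd1 : HasDerivAt (fun x : ℝ => x - 1) 1 l := (hasDerivAt_id l).sub_const 1
  have hdQ : HasDerivAt (fun x => (polyPart n).eval (x - 1))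
      ((Polynomial.derivative (polyPart n)).eval (l - 1) * 1) l :=
    HasDerivAt.comp (h₂ := fun y => (polyPart n).eval y) l ((polyPart n).hasDerivAt (l - 1)) hd1
  have hd := ((hdQ.div (hd1.pow (2 * n + 1)) (pow_ne_zero _ hm)).sub
    (((hasDerivAt_eta hl h1).pow (2 * n + 1)).fun_inv (pow_ne_zero _ he)
      |>.const_mul (oddFactorial n))).const_mul ((-1) ^ n)
  refine (hd.congr_of_eventuallyEq ?_).congr_deriv ?_
  · filter_upwards [hev] with x hx
    rw [hx]; simp [div_eq_mul_inv]
  rw [coefFun_eq (n + 1) hl h1, polyPart_succ, oddFactorial_succ]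
  have hs : ((-1 : ℝ) ^ n) * (-1) ^ n = 1 := by rw [← mul_pow]; simp
  simp only [Polynomial.eval_add, Polynomial.eval_mul, Polynomial.eval_sub, Polynomial.eval_one,
    Polynomial.eval_X, Polynomial.eval_natCast, Polynomial.eval_C, Polynomial.eval_pow,
    Pi.pow_apply, Nat.add_sub_cancel]
  have e1 : 2 * (n + 1) + 1 = 2 * n + 3 := by ring
  rw [e1]
  generalize (polyPart n).eval (l - 1) = q
  generalize (Polynomial.derivative (polyPart n)).eval (l - 1) = q'
  generalize stirlingCoeff (n + 1) = γ
  generalize oddFactorial n = d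
  have hl1 : l = 1 + (l - 1) := by ring
  generalize l - 1 = m at *
  generalize eta l = e at *
  push_cast
  simp only [pow_succ (-1 : ℝ)]
  generalize (-1 : ℝ) ^ n = s at *
  obtain ⟨c, rfl⟩ : ∃ c, γ = s * c := ⟨s * γ, by rw [← mul_assoc, hs, one_mul]⟩
  have hc : s * -1 * (s * c) = -c := by linear_combination (-c) * hs
  rw [hc]
  subst hl1
  have hm2 : 1 + m ≠ 0 := hl.ne'
  field_simp
  ring

lemma continuousAt_coefFun (n : ℕ) {l : ℝ} (hl : 0 < l) : ContinuousAt (coefFun n) l := by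
  by_cases h1 : l = 1
  · subst h1
    have h := (analyticAt_iterate_dslope (analyticAt_singularPart n) (2 * n + 1)).continuousAt
    have hsub : ContinuousAt (fun x : ℝ => x - 1) 1 := by fun_prop
    refine ContinuousAt.mul continuousAt_const ?_
    exact ContinuousAt.comp (f := fun x : ℝ => x - 1) (by simpa using h) hsub
  · exact (hasDerivAt_coefFun n hl h1).continuousAt

lemma sub_one_mul_coefFun_zero {l : ℝ} (hl : 0 < l) (h1 : l ≠ 1) :
    (l - 1) * coefFun 0 l = 1 - (l - 1) / eta l := by
  have hm : l - 1 ≠ 0 := sub_ne_zero.mpr h1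
  rw [coefFun_eq 0 hl h1, polyPart_zero, oddFactorial_zero]
  simp
  field_simp

/-- A continuous function on `(0, ∞)` which is bounded near both ends is bounded. -/
lemma exists_bound_of_isBigO {f : ℝ → ℝ} (hc : ∀ l, 0 < l → ContinuousAt f l)
    (h0 : f =O[𝓝[>] 0] (fun _ => (1 : ℝ))) (h1 : f =O[atTop] (fun _ => (1 : ℝ))) :
    ∃ K, 0 ≤ K ∧ ∀ l, 0 < l → |f l| ≤ K := by
  obtain ⟨K0, hK0⟩ := h0.bound
  obtain ⟨K1, hK1⟩ := h1.bound
  obtain ⟨ε, hε, hε'⟩ := mem_nhdsGT_iff_exists_Ioo_subset.mp hK0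
  obtain ⟨M, hM⟩ := eventually_atTop.mp hK1
  have hε0 : (0 : ℝ) < ε := hε
  obtain ⟨K2, hK2⟩ := (isCompact_Icc (a := ε) (b := M)).exists_bound_of_continuousOn (f := f)
    fun x hx => (hc x (hε0.trans_le hx.1)).continuousWithinAt
  refine ⟨max 0 (max K0 (max K1 K2)), le_max_left _ _, fun l hl => ?_⟩
  rcases lt_or_ge l ε with h | h
  · have h2 : ‖f l‖ ≤ K0 * ‖(1 : ℝ)‖ := hε' ⟨hl, h⟩
    simp only [norm_one, mul_one, Real.norm_eq_abs] at h2
    exact h2.trans (by simp)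
  rcases le_total l M with h' | h'
  · exact (hK2 l ⟨h, h'⟩).trans (by simp)
  · have h2 := hM l h'
    simp only [norm_one, mul_one, Real.norm_eq_abs] at h2
    exact h2.trans (by simp)

lemma tendsto_inv_eta_pow_zero (n : ℕ) :
    Tendsto (fun l => (eta l ^ (2 * n + 1))⁻¹) (𝓝[>] 0) (𝓝 0) := by
  have h : Tendsto (fun l => (eta l)⁻¹ ^ (2 * n + 1)) (𝓝[>] 0) (𝓝 (0 ^ (2 * n + 1))) :=
    (tendsto_inv_atBot_zero.comp tendsto_eta_zero).pow _
  simpa using h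

lemma tendsto_inv_eta_pow_atTop (n : ℕ) :
    Tendsto (fun l => (eta l ^ (2 * n + 1))⁻¹) atTop (𝓝 0) := by
  have h : Tendsto (fun l => (eta l)⁻¹ ^ (2 * n + 1)) atTop (𝓝 (0 ^ (2 * n + 1))) :=
    (tendsto_inv_atTop_zero.comp tendsto_eta_atTop).pow _
  simpa using h

lemma tendsto_coefFun_zero (n : ℕ) :
    Tendsto (coefFun n) (𝓝[>] 0)
      (𝓝 ((-1) ^ n * ((polyPart n).eval (0 - 1) / (0 - 1) ^ (2 * n + 1) - oddFactorial n * 0))) := by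
  have hQ : Tendsto (fun l : ℝ => (polyPart n).eval (l - 1) / (l - 1) ^ (2 * n + 1)) (𝓝[>] 0)
      (𝓝 ((polyPart n).eval (0 - 1) / (0 - 1) ^ (2 * n + 1))) := by
    have hc : ContinuousAt (fun l : ℝ => (polyPart n).eval (l - 1) / (l - 1) ^ (2 * n + 1)) 0 := by
      refine ContinuousAt.div ?_ (by fun_prop) (by simp)
      exact ((polyPart n).continuous.comp (continuous_id.sub continuous_const)).continuousAt
    exact hc.tendsto.mono_left nhdsWithin_le_nhds
  have h := (hQ.sub ((tendsto_inv_eta_pow_zero n).const_mul (oddFactorial n))).const_mul ((-1) ^ n)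
  refine h.congr' ?_
  filter_upwards [Ioo_mem_nhdsGT one_pos] with l hl
  rw [coefFun_eq n hl.1 hl.2.ne, div_eq_mul_inv (oddFactorial n)]

lemma isBigO_polyPart (n : ℕ) :
    (fun l : ℝ => (polyPart n).eval (l - 1)) =O[atTop] fun l => (l - 1) ^ (2 * n) := by
  have h : (fun x : ℝ => (polyPart n).eval x) =O[atTop]
      fun x => (Polynomial.X ^ (2 * n) : Polynomial ℝ).eval x := by
    refine Polynomial.isBigO_atTop_of_degree_le _ _ ?_
    rw [Polynomial.degree_X_pow]
    exact Polynomial.degree_le_of_natDegree_le (natDegree_polyPart_le n)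
  have ht : Tendsto (fun l : ℝ => l - 1) atTop atTop :=
    tendsto_atTop_add_const_right _ (-1) tendsto_id
  simpa [Function.comp_def] using h.comp_tendsto ht

/-- For `n ≥ 1`, the function `μ C n` is bounded on `(0, ∞)`. -/
lemma exists_bound_sub_one_mul_coefFun (n : ℕ) (hn : 1 ≤ n) :
    ∃ K, 0 ≤ K ∧ ∀ l, 0 < l → |(l - 1) * coefFun n l| ≤ K := by
  refine exists_bound_of_isBigO ?_ ?_ ?_
  · intro l hl
    exact ContinuousAt.mul (by fun_prop) (continuousAt_coefFun n hl)
  · have h : Tendsto (fun l : ℝ => l - 1) (𝓝[>] 0) (𝓝 (0 - 1)) :=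
      (continuous_id.sub continuous_const).continuousAt.tendsto.mono_left nhdsWithin_le_nhds
    exact (h.mul (tendsto_coefFun_zero n)).isBigO_one ℝ
  · -- As `l → ∞`, the degree of `Q n` bounds the first term, and `2 η² ≥ μ` the second.
    have h1 : (fun l : ℝ => (l - 1) * ((polyPart n).eval (l - 1) / (l - 1) ^ (2 * n + 1)))
        =O[atTop] fun _ => (1 : ℝ) := by
      obtain ⟨K, hK⟩ := (isBigO_polyPart n).bound
      refine IsBigO.of_bound K ?_
      filter_upwards [hK, eventually_gt_atTop 1] with l hl h1
      have hp : 0 < (l - 1) ^ (2 * n) := pow_pos (by linarith) _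
      have hm : l - 1 ≠ 0 := by linarith
      have e : (l - 1) * ((polyPart n).eval (l - 1) / (l - 1) ^ (2 * n + 1)) =
          (polyPart n).eval (l - 1) / (l - 1) ^ (2 * n) := by
        rw [pow_succ]; field_simp
      rw [e, norm_div, norm_one, mul_one, div_le_iff₀ (norm_pos_iff.mpr hp.ne')]
      exact hl
    have h2 : (fun l : ℝ => (l - 1) * (oddFactorial n / eta l ^ (2 * n + 1)))
        =O[atTop] fun _ => (1 : ℝ) := by
      refine IsBigO.of_bound (2 * |oddFactorial n|) ?_
      filter_upwards [eventually_ge_atTop 4, tendsto_eta_atTop.eventually_ge_atTop 1] with l hl he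
      have hl0 : 0 < l := by linarith
      have h3 : eta l ^ 2 ≤ eta l ^ (2 * n + 1) := pow_le_pow_right₀ he (by omega)
      have h4 := phi_ge l hl0
      have h5 := eta_sq hl0
      have h6 : Real.log 2 < 1 := Real.log_two_lt_d9.trans (by norm_num)
      have h7 : l - 1 ≤ 2 * eta l ^ (2 * n + 1) := by linarith
      have h8 : 0 < eta l ^ (2 * n + 1) := by positivity
      rw [norm_one, mul_one, norm_mul, norm_div, Real.norm_eq_abs, Real.norm_eq_abs,
        Real.norm_eq_abs, abs_of_pos h8, abs_of_nonneg (by linarith), mul_div_assoc',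
        div_le_iff₀ h8]
      nlinarith [abs_nonneg (oddFactorial n)]
    have h := (h1.sub h2).const_mul_left ((-1) ^ n)
    refine h.congr' ?_ EventuallyEq.rfl
    filter_upwards [eventually_gt_atTop 1] with l hl
    rw [coefFun_eq n (by linarith) hl.ne']
    ring

/-- The coefficients `C n` are bounded on `(0, ∞)`. -/
lemma exists_bound_coefFun (n : ℕ) : ∃ K, 0 ≤ K ∧ ∀ l, 0 < l → |coefFun n l| ≤ K := by
  refine exists_bound_of_isBigO (fun l hl => continuousAt_coefFun n hl)
    ((tendsto_coefFun_zero n).isBigO_one ℝ) ?_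
  have h1 : (fun l : ℝ => (polyPart n).eval (l - 1) / (l - 1) ^ (2 * n + 1))
      =O[atTop] fun _ => (1 : ℝ) := by
    obtain ⟨K, hK⟩ := (isBigO_polyPart n).bound
    refine IsBigO.of_bound K ?_
    filter_upwards [hK, eventually_ge_atTop 2] with l hl h2
    have hp : 0 < (l - 1) ^ (2 * n) := pow_pos (by linarith) _
    rw [norm_div, norm_one, mul_one, div_le_iff₀ (norm_pos_iff.mpr (pow_ne_zero _ (by linarith)))]
    have hK0 : 0 ≤ K := by
      by_contra hneg
      have := mul_neg_of_neg_of_pos (not_le.mp hneg) (norm_pos_iff.mpr hp.ne')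
      linarith [norm_nonneg ((polyPart n).eval (l - 1))]
    refine hl.trans (mul_le_mul_of_nonneg_left ?_ hK0)
    rw [norm_pow, norm_pow]
    refine pow_le_pow_right₀ ?_ (by omega)
    rw [Real.norm_eq_abs, abs_of_nonneg (by linarith)]; linarith
  have h2 := ((tendsto_inv_eta_pow_atTop n).const_mul (oddFactorial n)).isBigO_one ℝ
  have h := (h1.sub h2).const_mul_left ((-1) ^ n)
  refine h.congr' ?_ EventuallyEq.rfl
  filter_upwards [eventually_gt_atTop 1] with l hl
  rw [coefFun_eq n (by linarith) hl.ne', div_eq_mul_inv (oddFactorial n)]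

end Temme

/-! ### The incomplete gamma function and the complementary error function -/

namespace Temme

open Filter Topology Function MeasureTheory

lemma hasDerivAt_integral_Ioi {f : ℝ → ℝ} {c x : ℝ} (hf : IntegrableOn f (Set.Ioi c))
    (hcx : c < x) (hfx : ContinuousAt f x) :
    HasDerivAt (fun y => ∫ t in Set.Ioi y, f t) (-f x) x := by
  have hint : IntervalIntegrable f volume c x :=
    (intervalIntegrable_iff_integrableOn_Ioc_of_le hcx.le).mpr
      (hf.mono_set Set.Ioc_subset_Ioi_self)
  have hmeas : StronglyMeasurableAtFilter f (𝓝 x) :=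
    ⟨Set.Ioi c, Ioi_mem_nhds hcx, hf.aestronglyMeasurable⟩
  have h := (intervalIntegral.integral_hasDerivAt_right hint hmeas hfx).const_sub
    (∫ t in Set.Ioi c, f t)
  refine h.congr_of_eventuallyEq ?_
  filter_upwards [Ioi_mem_nhds hcx] with y hy
  have hy' : c < y := hy
  rw [← intervalIntegral.integral_Ioi_sub_Ioi hf hy'.le]
  ring

lemma hasDerivAt_incompleteGamma {a x : ℝ} (ha : 0 < a) (hx : 0 < x) :
    HasDerivAt (incompleteGamma a) (-(Real.exp (-x) * x ^ (a - 1))) x := by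
  refine hasDerivAt_integral_Ioi (Real.GammaIntegral_convergent ha) hx ?_
  exact ContinuousAt.mul (by fun_prop) (Real.continuousAt_rpow_const _ _ (Or.inl hx.ne'))

lemma tendsto_incompleteGamma_atTop (a : ℝ) : Tendsto (incompleteGamma a) atTop (𝓝 0) :=
  tendsto_integral_Ioi_zero tendsto_id

lemma tendsto_incompleteGamma_zero {a : ℝ} (ha : 0 < a) :
    Tendsto (incompleteGamma a) (𝓝[>] 0) (𝓝 (Real.Gamma a)) := by
  have hid : Tendsto (fun x : ℝ => x) (𝓝[>] 0) (𝓝 0) := nhdsWithin_le_nhds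
  have h := (aecover_Ioi_of_Ioi (μ := volume) hid).integral_tendsto_of_countably_generated
    (Real.GammaIntegral_convergent ha)
  rw [← Real.Gamma_eq_integral ha] at h
  refine h.congr' ?_
  filter_upwards [self_mem_nhdsWithin] with x hx
  rw [incompleteGamma, Measure.restrict_restrict measurableSet_Ioi,
    Set.inter_eq_left.mpr (Set.Ioi_subset_Ioi (le_of_lt hx))]

lemma integrable_exp_neg_sq : Integrable fun t : ℝ => Real.exp (-t ^ 2) := by
  simpa using integrable_exp_neg_mul_sq (b := 1) one_pos

lemma hasDerivAt_erfc (x : ℝ) :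
    HasDerivAt erfc (-(2 / √Real.pi * Real.exp (-x ^ 2))) x := by
  have h := (hasDerivAt_integral_Ioi (c := x - 1) integrable_exp_neg_sq.integrableOn
    (by linarith) (x := x) (by fun_prop)).const_mul (2 / √Real.pi)
  exact h.congr_deriv (by ring)

lemma tendsto_erfc_atTop : Tendsto erfc atTop (𝓝 0) := by
  have h := (tendsto_integral_Ioi_zero (μ := volume) (f := fun t : ℝ => Real.exp (-t ^ 2))
    tendsto_id).const_mul (2 / √Real.pi)
  rwa [mul_zero] at h

lemma tendsto_erfc_atBot : Tendsto erfc atBot (𝓝 2) := by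
  have h := ((aecover_Ioi (μ := volume) tendsto_id).integral_tendsto_of_countably_generated
    integrable_exp_neg_sq).const_mul (2 / √Real.pi)
  have hg : ∫ t : ℝ, Real.exp (-t ^ 2) = √Real.pi := by
    simpa using integral_gaussian 1
  have hpi : √Real.pi ≠ 0 := (Real.sqrt_pos.mpr Real.pi_pos).ne'
  rw [hg, div_mul_cancel₀ _ hpi] at h
  exact h

/-! ### Comparison principles for functions vanishing at both ends of `(0, ∞)` -/

lemma nonneg_of_deriv_nonpos {f f' : ℝ → ℝ} (hc : ∀ l, 0 < l → ContinuousAt f l)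
    (hd : ∀ l, 1 < l → HasDerivAt f (f' l) l) (hf' : ∀ l, 1 < l → f' l ≤ 0)
    (h0 : Tendsto f atTop (𝓝 0)) {l : ℝ} (hl : 1 ≤ l) : 0 ≤ f l := by
  have hanti : AntitoneOn f (Set.Ici 1) := by
    refine antitoneOn_of_deriv_nonpos (convex_Ici 1)
      (fun x hx => (hc x (one_pos.trans_le hx)).continuousWithinAt) ?_ ?_
    · intro x hx
      rw [interior_Ici] at hx
      exact (hd x hx).differentiableAt.differentiableWithinAt
    · intro x hx
      rw [interior_Ici] at hx
      rw [(hd x hx).deriv]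
      exact hf' x hx
  refine le_of_tendsto h0 ?_
  filter_upwards [eventually_ge_atTop l] with x hx
  exact hanti hl (hl.trans hx) hx

lemma nonneg_of_deriv_nonneg {f f' : ℝ → ℝ} (hc : ∀ l, 0 < l → ContinuousAt f l)
    (hd : ∀ l, 0 < l → l < 1 → HasDerivAt f (f' l) l) (hf' : ∀ l, 0 < l → l < 1 → 0 ≤ f' l)
    (h0 : Tendsto f (𝓝[>] 0) (𝓝 0)) {l : ℝ} (hl : 0 < l) (hl1 : l ≤ 1) : 0 ≤ f l := by
  have hmono : MonotoneOn f (Set.Ioc 0 1) := by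
    refine monotoneOn_of_deriv_nonneg (convex_Ioc 0 1)
      (fun x hx => (hc x hx.1).continuousWithinAt) ?_ ?_
    · intro x hx
      rw [interior_Ioc] at hx
      exact (hd x hx.1 hx.2).differentiableAt.differentiableWithinAt
    · intro x hx
      rw [interior_Ioc] at hx
      rw [(hd x hx.1 hx.2).deriv]
      exact hf' x hx.1 hx.2
  refine le_of_tendsto h0 ?_
  filter_upwards [Ioo_mem_nhdsGT hl] with x hx
  exact hmono ⟨hx.1, hx.2.le.trans hl1⟩ ⟨hl, hl1⟩ hx.2.le

/-- The derivative of a function vanishing at both ends of `(0, ∞)` cannot have a strict sign. -/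
lemma le_of_vanishing_ends {f w b : ℝ → ℝ} {δ B : ℝ} (hc : ∀ l, 0 < l → ContinuousAt f l)
    (hd : ∀ l, 0 < l → l ≠ 1 → HasDerivAt f (-(w l * (δ + b l))) l) (hw : ∀ l, 0 < l → 0 < w l)
    (hb : ∀ l, 0 < l → |b l| ≤ B) (h0 : Tendsto f (𝓝[>] 0) (𝓝 0))
    (h1 : Tendsto f atTop (𝓝 0)) : δ ≤ B := by
  by_contra! hδ
  have hneg : ∀ l, 0 < l → -(w l * (δ + b l)) < 0 := fun l hl => by
    have h2 := (abs_le.mp (hb l hl)).1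
    exact neg_neg_of_pos (mul_pos (hw l hl) (by linarith))
  have hanti : StrictAntiOn f (Set.Ici 1) := by
    refine strictAntiOn_of_deriv_neg (convex_Ici 1)
      (fun x hx => (hc x (one_pos.trans_le hx)).continuousWithinAt) fun x hx => ?_
    rw [interior_Ici] at hx
    have hx' : (1 : ℝ) < x := hx
    rw [(hd x (by linarith) hx'.ne').deriv]
    exact hneg x (by linarith)
  have h2 : 0 ≤ f 2 := by
    refine nonneg_of_deriv_nonpos hc (fun l hl => hd l (by linarith) hl.ne')
      (fun l hl => (hneg l (by linarith)).le) h1 (by norm_num)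
  have h3 : 0 ≤ -f 1 := by
    have h0' : Tendsto (fun l => -f l) (𝓝[>] 0) (𝓝 0) := by simpa using h0.neg
    exact nonneg_of_deriv_nonneg (f := fun l => -f l) (fun l hl => (hc l hl).neg)
      (fun l hl hl1 => (hd l hl hl1.ne).neg)
      (fun l hl _ => by linarith [hneg l hl]) h0' one_pos le_rfl
  have h4 := hanti (Set.mem_Ici.mpr le_rfl) (Set.mem_Ici.mpr one_le_two) one_lt_two
  linarith

/-- If `f` vanishes at both ends of `(0, ∞)` and `f' = -w (δ + b)` with `w > 0`, then `|δ|` is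
at most any upper bound of `|b|`. -/
lemma abs_le_of_vanishing_ends {f w b : ℝ → ℝ} {δ B : ℝ} (hc : ∀ l, 0 < l → ContinuousAt f l)
    (hd : ∀ l, 0 < l → l ≠ 1 → HasDerivAt f (-(w l * (δ + b l))) l) (hw : ∀ l, 0 < l → 0 < w l)
    (hb : ∀ l, 0 < l → |b l| ≤ B) (h0 : Tendsto f (𝓝[>] 0) (𝓝 0))
    (h1 : Tendsto f atTop (𝓝 0)) : |δ| ≤ B := by
  refine abs_le'.mpr ⟨le_of_vanishing_ends hc hd hw hb h0 h1, ?_⟩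
  refine le_of_vanishing_ends (f := fun l => -f l) (b := fun l => -b l) (w := w)
    (fun l hl => (hc l hl).neg) (fun l hl hl1 => ((hd l hl hl1).neg).congr_deriv (by ring)) hw
    (fun l hl => by rw [abs_neg]; exact hb l hl) (by simpa using h0.neg) (by simpa using h1.neg)

lemma tendsto_exp_neg_mul_phi_zero {a : ℝ} (ha : 0 < a) :
    Tendsto (fun l => Real.exp (-(a * phi l))) (𝓝[>] 0) (𝓝 0) :=
  Real.tendsto_exp_atBot.comp
    (tendsto_neg_atTop_atBot.comp (tendsto_phi_zero.const_mul_atTop ha))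

lemma tendsto_exp_neg_mul_phi_atTop {a : ℝ} (ha : 0 < a) :
    Tendsto (fun l => Real.exp (-(a * phi l))) atTop (𝓝 0) :=
  Real.tendsto_exp_atBot.comp
    (tendsto_neg_atTop_atBot.comp (tendsto_phi_atTop.const_mul_atTop ha))

lemma hasDerivAt_exp_neg_mul_phi (a : ℝ) {l : ℝ} (hl : 0 < l) :
    HasDerivAt (fun l => Real.exp (-(a * phi l)))
      (-(a * ((l - 1) / l)) * Real.exp (-(a * phi l))) l :=
  ((hasDerivAt_phi hl).const_mul a).fun_neg.exp.congr_deriv (by ring)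

/-- If `f` vanishes at both ends of `(0, ∞)` and `|f'| ≤ M e^{-aφ} / l`, then `f` is at most
`2 M e^{-aφ}`. -/
lemma abs_le_exp_of_abs_deriv_le {f f' : ℝ → ℝ} {a M : ℝ} (ha : 1 ≤ a)
    (hc : ∀ l, 0 < l → ContinuousAt f l)
    (hd : ∀ l, 0 < l → l ≠ 1 → HasDerivAt f (f' l) l)
    (hf' : ∀ l, 0 < l → l ≠ 1 → |f' l| ≤ M * (Real.exp (-(a * phi l)) / l))
    (h0 : Tendsto f (𝓝[>] 0) (𝓝 0)) (h1 : Tendsto f atTop (𝓝 0)) {l : ℝ} (hl : 0 < l) :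
    |f l| ≤ 2 * M * Real.exp (-(a * phi l)) := by
  have ha0 : 0 < a := by linarith
  have hM : 0 ≤ M := by
    have h2 := (abs_nonneg _).trans (hf' 2 two_pos (by norm_num))
    exact nonneg_of_mul_nonneg_left h2 (by positivity)
  have hE := fun (l : ℝ) (hl : 0 < l) => hasDerivAt_exp_neg_mul_phi a hl
  rcases le_total 1 l with hl1 | hl1
  · -- The factor `1 + 1/l` makes `-g' ≥ e^{-aφ} / l` hold on the whole of `[1, ∞)`.
    have hg : ∀ x, 0 < x → HasDerivAt (fun x => M * (Real.exp (-(a * phi x)) * (1 + x⁻¹)))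
        (-(M * (Real.exp (-(a * phi x)) / x * (a * (x - 1) * (1 + x⁻¹) + x⁻¹)))) x := by
      intro x hx
      refine (((hE x hx).mul ((hasDerivAt_inv hx.ne').const_add 1)).const_mul M).congr_deriv ?_
      field_simp
      ring
    have hg' : ∀ x, 1 < x → M * (Real.exp (-(a * phi x)) / x) ≤
        M * (Real.exp (-(a * phi x)) / x * (a * (x - 1) * (1 + x⁻¹) + x⁻¹)) := by
      intro x hx
      have hx0 : 0 < x := by linarith
      refine mul_le_mul_of_nonneg_left (le_mul_of_one_le_right (by positivity) ?_) hM
      have h3 : 1 * ((x - 1) * (1 + x⁻¹)) ≤ a * ((x - 1) * (1 + x⁻¹)) :=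
        mul_le_mul_of_nonneg_right ha (mul_nonneg (by linarith) (by positivity))
      have h4 : (x - 1) * (1 + x⁻¹) + x⁻¹ = x := by field_simp; ring
      linarith
    have hg0 : Tendsto (fun x => M * (Real.exp (-(a * phi x)) * (1 + x⁻¹))) atTop (𝓝 0) := by
      simpa using ((tendsto_exp_neg_mul_phi_atTop ha0).mul
        (tendsto_inv_atTop_zero.const_add 1)).const_mul M
    have hp := nonneg_of_deriv_nonpos (fun x hx => (hg x hx).continuousAt.fun_add (hc x hx))
      (fun x hx => (hg x (by linarith)).fun_add (hd x (by linarith) hx.ne')) (fun x hx => by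
        have h5 := hf' x (by linarith) hx.ne'
        have h6 := hg' x hx
        linarith [le_abs_self (f' x)]) (by simpa using hg0.add h1) hl1
    have hm := nonneg_of_deriv_nonpos (fun x hx => (hg x hx).continuousAt.fun_sub (hc x hx))
      (fun x hx => (hg x (by linarith)).fun_sub (hd x (by linarith) hx.ne')) (fun x hx => by
        have h5 := hf' x (by linarith) hx.ne'
        have h6 := hg' x hx
        linarith [neg_abs_le (f' x)]) (by simpa using hg0.sub h1) hl1
    have h7 : M * (Real.exp (-(a * phi l)) * (1 + l⁻¹)) ≤ 2 * M * Real.exp (-(a * phi l)) := by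
      have h8 : l⁻¹ ≤ 1 := inv_le_one_of_one_le₀ hl1
      have h9 : 0 ≤ M * Real.exp (-(a * phi l)) := by positivity
      nlinarith
    exact abs_le.mpr ⟨by linarith, by linarith⟩
  · -- On `(0, 1]` the factor `1 + l` plays the same role, with `g' ≥ e^{-aφ} / l`.
    have hg : ∀ x, 0 < x → HasDerivAt (fun x => M * (Real.exp (-(a * phi x)) * (1 + x)))
        (M * (Real.exp (-(a * phi x)) / x * (a * (1 - x) * (1 + x) + x))) x := by
      intro x hx
      refine (((hE x hx).mul ((hasDerivAt_id x).const_add 1)).const_mul M).congr_deriv ?_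
      simp only [id]
      field_simp
      ring
    have hg' : ∀ x, 0 < x → x < 1 → M * (Real.exp (-(a * phi x)) / x) ≤
        M * (Real.exp (-(a * phi x)) / x * (a * (1 - x) * (1 + x) + x)) := by
      intro x hx0 hx
      refine mul_le_mul_of_nonneg_left (le_mul_of_one_le_right (by positivity) ?_) hM
      have h3 : 1 * ((1 - x) * (1 + x)) ≤ a * ((1 - x) * (1 + x)) :=
        mul_le_mul_of_nonneg_right ha (mul_nonneg (by linarith) (by positivity))
      nlinarith
    have hg0 : Tendsto (fun x => M * (Real.exp (-(a * phi x)) * (1 + x))) (𝓝[>] 0) (𝓝 0) := by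
      have hid : Tendsto (fun x : ℝ => x) (𝓝[>] 0) (𝓝 0) := nhdsWithin_le_nhds
      simpa using ((tendsto_exp_neg_mul_phi_zero ha0).mul (hid.const_add 1)).const_mul M
    have hp := nonneg_of_deriv_nonneg (fun x hx => (hg x hx).continuousAt.fun_add (hc x hx))
      (fun x hx0 hx => (hg x hx0).fun_add (hd x hx0 hx.ne)) (fun x hx0 hx => by
        have h5 := hf' x hx0 hx.ne
        have h6 := hg' x hx0 hx
        linarith [neg_abs_le (f' x)]) (by simpa using hg0.add h0) hl hl1
    have hm := nonneg_of_deriv_nonneg (fun x hx => (hg x hx).continuousAt.fun_sub (hc x hx))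
      (fun x hx0 hx => (hg x hx0).fun_sub (hd x hx0 hx.ne)) (fun x hx0 hx => by
        have h5 := hf' x hx0 hx.ne
        have h6 := hg' x hx0 hx
        linarith [le_abs_self (f' x)]) (by simpa using hg0.sub h0) hl hl1
    have h7 : M * (Real.exp (-(a * phi l)) * (1 + l)) ≤ 2 * M * Real.exp (-(a * phi l)) := by
      have h9 : 0 ≤ M * Real.exp (-(a * phi l)) := by positivity
      nlinarith
    exact abs_le.mpr ⟨by linarith, by linarith⟩

end Temme

/-! ### The remainder of the expansion -/

namespace Temme

open Filter Topology Function

/-- The remainder of the expansion after `N` terms, as a function of `l`, with `e^{-aη²/2}` written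
as `e^{-aφ(l)}`. -/
def remainder (a : ℝ) (N : ℕ) (l : ℝ) : ℝ :=
  incompleteGamma a (l * a) / Real.Gamma a
    - (1 / 2 * erfc (eta l * √(1 / 2 * a))
      + Real.exp (-(a * phi l)) / √(2 * Real.pi * a)
        * ∑ n ∈ Finset.range N, coefFun n l / a ^ n)

/-- The quotient `aᵃ e^{-a} √(2π/a) / Γ(a)`, which tends to `1` by Stirling's formula. -/
def stirlingRatio (a : ℝ) : ℝ :=
  a ^ a * Real.exp (-a) * √(2 * Real.pi * a) / (a * Real.Gamma a)

lemma continuousAt_remainder {a : ℝ} (ha : 0 < a) (N : ℕ) {l : ℝ} (hl : 0 < l) :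
    ContinuousAt (remainder a N) l := by
  have h1 : ContinuousAt (fun l => incompleteGamma a (l * a)) l :=
    ContinuousAt.comp (f := fun l => l * a)
      (hasDerivAt_incompleteGamma ha (mul_pos hl ha)).continuousAt (by fun_prop)
  have h2 : ContinuousAt (fun l => erfc (eta l * √(1 / 2 * a))) l :=
    ContinuousAt.comp (f := fun l => eta l * √(1 / 2 * a))
      (hasDerivAt_erfc _).continuousAt ((continuousAt_eta hl).mul continuousAt_const)
  have h3 := (hasDerivAt_exp_neg_mul_phi a hl).continuousAt
  have h4 : ContinuousAt (fun l => ∑ n ∈ Finset.range N, coefFun n l / a ^ n) l :=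
    tendsto_finsetSum _ fun n _ => (continuousAt_coefFun n hl).div_const _
  exact (h1.div_const _).sub ((continuousAt_const.mul h2).add ((h3.div_const _).mul h4))

/-- The finite sum in the expansion vanishes at both ends of `(0, ∞)`, because the coefficients are
bounded. -/
lemma tendsto_exp_mul_sum {a : ℝ} {F : Filter ℝ} (hF : ∀ᶠ l in F, 0 < l)
    (h : Tendsto (fun l => Real.exp (-(a * phi l))) F (𝓝 0)) (N : ℕ) :
    Tendsto (fun l => Real.exp (-(a * phi l)) / √(2 * Real.pi * a)
        * ∑ n ∈ Finset.range N, coefFun n l / a ^ n) F (𝓝 0) := by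
  have h0 : Tendsto (fun l => Real.exp (-(a * phi l)) / √(2 * Real.pi * a)) F (𝓝 0) := by
    simpa using h.div_const (√(2 * Real.pi * a))
  have hb : ∀ n, IsBoundedUnder (· ≤ ·) F (norm ∘ fun l => coefFun n l / a ^ n) := by
    intro n
    obtain ⟨K, _, hK⟩ := exists_bound_coefFun n
    refine isBoundedUnder_of_eventually_le (a := K / |a ^ n|) ?_
    filter_upwards [hF] with l hl
    rw [comp_apply, Real.norm_eq_abs, abs_div]
    exact div_le_div_of_nonneg_right (hK l hl) (abs_nonneg _)
  simp_rw [Finset.mul_sum]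
  have hs := tendsto_finsetSum (Finset.range N) fun n _ =>
    h0.zero_mul_isBoundedUnder_le (hb n)
  simpa using hs

lemma tendsto_remainder_atTop {a : ℝ} (ha : 0 < a) (N : ℕ) :
    Tendsto (remainder a N) atTop (𝓝 0) := by
  have h1 := ((tendsto_incompleteGamma_atTop a).comp
    (tendsto_id.atTop_mul_const ha)).div_const (Real.Gamma a)
  have h2 := (tendsto_erfc_atTop.comp (tendsto_eta_atTop.atTop_mul_const
    (Real.sqrt_pos.mpr (by positivity : 0 < 1 / 2 * a)))).const_mul (1 / 2)
  have h3 := tendsto_exp_mul_sum (eventually_gt_atTop 0) (tendsto_exp_neg_mul_phi_atTop ha) N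
  have h := h1.sub (h2.add h3)
  simp only [mul_zero, zero_div, add_zero, sub_zero] at h
  exact h

lemma tendsto_remainder_zero {a : ℝ} (ha : 0 < a) (N : ℕ) :
    Tendsto (remainder a N) (𝓝[>] 0) (𝓝 0) := by
  have ht : Tendsto (fun l => l * a) (𝓝[>] 0) (𝓝[>] 0) := by
    refine tendsto_nhdsWithin_of_tendsto_nhds_of_eventually_within _ ?_ ?_
    · have hc : ContinuousAt (fun l : ℝ => l * a) 0 := by fun_prop
      have h := hc.tendsto
      rw [zero_mul] at h
      exact h.mono_left nhdsWithin_le_nhds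
    · filter_upwards [self_mem_nhdsWithin] with l hl using mul_pos hl ha
  have h1 := ((tendsto_incompleteGamma_zero ha).comp ht).div_const (Real.Gamma a)
  have h2 := (tendsto_erfc_atBot.comp (tendsto_eta_zero.atBot_mul_const
    (Real.sqrt_pos.mpr (by positivity : 0 < 1 / 2 * a)))).const_mul (1 / 2)
  have h3 := tendsto_exp_mul_sum self_mem_nhdsWithin (tendsto_exp_neg_mul_phi_zero ha) N
  have h := h1.sub (h2.add h3)
  rw [div_self (Real.Gamma_pos_of_pos ha).ne',
    show (1 : ℝ) - (1 / 2 * 2 + 0) = 0 by norm_num] at h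
  exact h

/-- The telescoping sum produced by the recurrence of the coefficients. -/
lemma sum_telescope {a : ℝ} (ha : a ≠ 0) (N : ℕ) (m : ℝ) (c γ : ℕ → ℝ) :
    ∑ n ∈ Finset.range N, (m * c (n + 1) - γ (n + 1)) / a ^ n
      - a * m * ∑ n ∈ Finset.range N, c n / a ^ n =
    a * (m * c N / a ^ N - m * c 0 + γ 0 - ∑ n ∈ Finset.range (N + 1), γ n / a ^ n) := by
  induction N with
  | zero => simp
  | succ N ih =>
    rw [Finset.sum_range_succ, Finset.sum_range_succ _ N, Finset.sum_range_succ _ (N + 1)]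
    have e : ∀ x y z w : ℝ, x + y - a * m * (z + w) = (x - a * m * z) + (y - a * m * w) := by
      intros; ring
    rw [e, ih]
    field_simp
    ring

/-- The recurrence of the coefficients makes all terms of the derivative of the remainder cancel,
except for the error of the truncated Stirling series and one term of order `a^{-N}`. -/
lemma hasDerivAt_remainder {a : ℝ} (ha : 0 < a) (N : ℕ) {l : ℝ} (hl : 0 < l) (h1 : l ≠ 1) :
    HasDerivAt (remainder a N)
      (-(a / √(2 * Real.pi * a) * (Real.exp (-(a * phi l)) / l)
        * ((stirlingRatio a - ∑ n ∈ Finset.range (N + 1), stirlingCoeff n / a ^ n)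
          + (l - 1) * coefFun N l / a ^ N))) l := by
  have he := eta_ne_zero hl h1
  have hG := (Real.Gamma_pos_of_pos ha).ne'
  have hr : √(2 * Real.pi * a) ≠ 0 :=
    (Real.sqrt_pos.mpr (by have := Real.pi_pos; positivity)).ne'
  have hpi : √Real.pi ≠ 0 := (Real.sqrt_pos.mpr Real.pi_pos).ne'
  have dG : HasDerivAt (fun l => incompleteGamma a (l * a))
      (-(Real.exp (-(l * a)) * (l * a) ^ (a - 1)) * (1 * a)) l :=
    HasDerivAt.comp (h₂ := incompleteGamma a) l (hasDerivAt_incompleteGamma ha (mul_pos hl ha))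
      ((hasDerivAt_id l).mul_const a)
  have dE : HasDerivAt (fun l => erfc (eta l * √(1 / 2 * a)))
      (-(2 / √Real.pi * Real.exp (-(eta l * √(1 / 2 * a)) ^ 2)) *
        ((l - 1) / (l * eta l) * √(1 / 2 * a))) l :=
    HasDerivAt.comp (h₂ := erfc) l (hasDerivAt_erfc _) ((hasDerivAt_eta hl h1).mul_const _)
  have dS : HasDerivAt (fun l => ∑ n ∈ Finset.range N, coefFun n l / a ^ n)
      (∑ n ∈ Finset.range N,
        ((l - 1) * coefFun (n + 1) l - stirlingCoeff (n + 1)) / l / a ^ n) l :=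
    HasDerivAt.fun_sum fun n _ => (hasDerivAt_coefFun n hl h1).div_const _
  have dX := (hasDerivAt_exp_neg_mul_phi a hl).div_const (√(2 * Real.pi * a))
  refine ((dG.div_const (Real.Gamma a)).sub ((dE.const_mul (1 / 2)).add
    (dX.mul dS))).congr_deriv ?_
  -- The derivative of the incomplete gamma function.
  have hg : Real.exp (-(l * a)) * (l * a) ^ (a - 1) * a =
      a ^ a * Real.exp (-a) * (Real.exp (-(a * phi l)) / l) := by
    have hla : (l * a) ^ (a - 1) = l ^ a * a ^ a / (l * a) := by
      rw [Real.rpow_sub_one (mul_pos hl ha).ne', Real.mul_rpow hl.le ha.le]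
    have hx : Real.exp (-(l * a)) * l ^ a = Real.exp (-a) * Real.exp (-(a * phi l)) := by
      rw [Real.rpow_def_of_pos hl, ← Real.exp_add, ← Real.exp_add, phi]
      congr 1; ring
    rw [hla]
    field_simp
    linear_combination hx
  -- The derivative of the complementary error function.
  have hsq : √(1 / 2 * a) ^ 2 = 1 / 2 * a := Real.sq_sqrt (by positivity)
  have hexp : -(eta l * √(1 / 2 * a)) ^ 2 = -(a * phi l) := by
    rw [mul_pow, hsq, eta_sq hl]; ring
  have hroot : √(1 / 2 * a) / √Real.pi = a / √(2 * Real.pi * a) := by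
    rw [div_eq_div_iff hpi hr, ← Real.sqrt_mul (by positivity)]
    rw [show 1 / 2 * a * (2 * Real.pi * a) = a ^ 2 * Real.pi by ring,
      Real.sqrt_mul (by positivity), Real.sqrt_sq ha.le]
  have htel := sum_telescope ha.ne' N (l - 1) (fun n => coefFun n l) stirlingCoeff
  have hS : ∑ n ∈ Finset.range N,
      ((l - 1) * coefFun (n + 1) l - stirlingCoeff (n + 1)) / l / a ^ n =
      (∑ n ∈ Finset.range N, ((l - 1) * coefFun (n + 1) l - stirlingCoeff (n + 1)) / a ^ n) / l := by
    rw [Finset.sum_div]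
    exact Finset.sum_congr rfl fun n _ => by ring
  simp only [sub_one_mul_coefFun_zero hl h1, stirlingCoeff_zero] at htel
  have e1 : -(Real.exp (-(l * a)) * (l * a) ^ (a - 1)) * (1 * a) / Real.Gamma a =
      -(a / √(2 * Real.pi * a) * (Real.exp (-(a * phi l)) / l) * stirlingRatio a) := by
    rw [one_mul, neg_mul, hg, stirlingRatio]
    field_simp
  have e2 : 1 / 2 * (-(2 / √Real.pi * Real.exp (-(eta l * √(1 / 2 * a)) ^ 2)) *
        ((l - 1) / (l * eta l) * √(1 / 2 * a))) =
      -(a / √(2 * Real.pi * a) * (Real.exp (-(a * phi l)) / l) * ((l - 1) / eta l)) := by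
    rw [hexp, ← hroot]
    field_simp
  rw [e1, e2, hS]
  generalize (∑ n ∈ Finset.range N,
    ((l - 1) * coefFun (n + 1) l - stirlingCoeff (n + 1)) / a ^ n) = S1 at *
  generalize (∑ n ∈ Finset.range N, coefFun n l / a ^ n) = S0 at *
  generalize (∑ n ∈ Finset.range (N + 1), stirlingCoeff n / a ^ n) = T at *
  generalize (l - 1) * coefFun N l / a ^ N = R at *
  generalize (l - 1) / eta l = q at *
  have hS1 : S1 = a * (l - 1) * S0 + a * (R - (1 - q) + 1 - T) := by linarith
  rw [hS1]
  field_simp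
  ring

/-- The bound of the remainder after `N ≥ 1` terms, which loses one power of `a`. -/
lemma exists_bound_remainder (N : ℕ) (hN : 1 ≤ N) : ∃ K, 0 ≤ K ∧ ∀ a, 1 ≤ a → ∀ l, 0 < l →
    |remainder a N l| ≤ K / a ^ N * (a * (Real.exp (-(a * phi l)) / √(2 * Real.pi * a))) := by
  obtain ⟨M, hM0, hM⟩ := exists_bound_sub_one_mul_coefFun N hN
  refine ⟨4 * M, by positivity, fun a ha1 l hl => ?_⟩
  have ha : 0 < a := by linarith
  have hr : 0 < √(2 * Real.pi * a) :=
    Real.sqrt_pos.mpr (by have := Real.pi_pos; positivity)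
  have hb : ∀ l, 0 < l → |(l - 1) * coefFun N l / a ^ N| ≤ M / a ^ N := fun l hl => by
    rw [abs_div, abs_of_pos (pow_pos ha N)]
    exact div_le_div_of_nonneg_right (hM l hl) (by positivity)
  have hδ := abs_le_of_vanishing_ends (fun l hl => continuousAt_remainder ha N hl)
    (fun l hl h1 => hasDerivAt_remainder ha N hl h1) (fun l hl => by positivity) hb
    (tendsto_remainder_zero ha N) (tendsto_remainder_atTop ha N)
  have h := abs_le_exp_of_abs_deriv_le (M := a / √(2 * Real.pi * a) * (2 * (M / a ^ N))) ha1
    (fun l hl => continuousAt_remainder ha N hl)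
    (fun l hl h1 => hasDerivAt_remainder ha N hl h1) (fun l hl _ => by
      have hw : 0 ≤ a / √(2 * Real.pi * a) * (Real.exp (-(a * phi l)) / l) := by positivity
      rw [abs_neg, abs_mul, abs_of_nonneg hw]
      calc _ ≤ a / √(2 * Real.pi * a) * (Real.exp (-(a * phi l)) / l) * (2 * (M / a ^ N)) := by
            refine mul_le_mul_of_nonneg_left ?_ hw
            linarith [abs_add_le (stirlingRatio a
              - ∑ n ∈ Finset.range (N + 1), stirlingCoeff n / a ^ n)
              ((l - 1) * coefFun N l / a ^ N), hb l hl]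
        _ = _ := by ring)
    (tendsto_remainder_zero ha N) (tendsto_remainder_atTop ha N) hl
  refine h.trans_eq ?_
  ring

/-- The coefficient `C n` as a function of `η`. Since `η` is injective on `(0, ∞)`, it is obtained
by inverting `η` there; its values outside the range of `η` are irrelevant. -/
def coef (n : ℕ) (y : ℝ) : ℝ := coefFun n (invFunOn eta (Set.Ioi 0) y)

lemma coef_eta (n : ℕ) {l : ℝ} (hl : 0 < l) : coef n (eta l) = coefFun n l := by
  rw [coef, injOn_eta.leftInvOn_invFunOn hl]

/-- The remainder after `N` terms is the one after `N + 1` terms plus a term of order `a^{-N}`, so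
the power of `a` lost in `exists_bound_remainder` does no harm. -/
lemma isUniformExpansion_coef : IsUniformExpansion coef := by
  intro N
  obtain ⟨K, _, hK⟩ := exists_bound_remainder (N + 1) (by omega)
  obtain ⟨M, _, hM⟩ := exists_bound_coefFun N
  refine ⟨K + M, ?_⟩
  filter_upwards [eventually_ge_atTop 1] with a ha1 l hl
  have ha : 0 < a := by linarith
  have hr : 0 < √(2 * Real.pi * a) :=
    Real.sqrt_pos.mpr (by have := Real.pi_pos; positivity)
  have hexp : -(1 / 2) * a * eta l ^ 2 = -(a * phi l) := by rw [eta_sq hl]; ring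
  simp_rw [coef_eta _ hl, hexp]
  have h1 := hK a ha1 l hl
  have h2 : remainder a N l = remainder a (N + 1) l
      + Real.exp (-(a * phi l)) / √(2 * Real.pi * a) * (coefFun N l / a ^ N) := by
    rw [remainder, remainder, Finset.sum_range_succ]; ring
  have h3 : |Real.exp (-(a * phi l)) / √(2 * Real.pi * a) * (coefFun N l / a ^ N)| ≤
      M * (Real.exp (-(a * phi l)) / √(2 * Real.pi * a) / a ^ N) := by
    have hw : 0 ≤ Real.exp (-(a * phi l)) / √(2 * Real.pi * a) / a ^ N := by positivity
    calc _ = |coefFun N l| * |Real.exp (-(a * phi l)) / √(2 * Real.pi * a) / a ^ N| := by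
          rw [← abs_mul]; congr 1; ring
      _ ≤ _ := by
          rw [abs_of_nonneg hw]
          exact mul_le_mul_of_nonneg_right (hM l hl) hw
  have h4 : K / a ^ (N + 1) * (a * (Real.exp (-(a * phi l)) / √(2 * Real.pi * a))) =
      K * (Real.exp (-(a * phi l)) / √(2 * Real.pi * a) / a ^ N) := by
    rw [pow_succ]; field_simp
  rw [h4] at h1
  change |remainder a N l| ≤ _
  rw [h2, add_mul]
  exact (abs_add_le _ _).trans (add_le_add h1 h3)

lemma isPolynomialPart_coef : IsPolynomialPart coef polyPart := by
  intro n l hl h1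
  rw [coef_eta n hl, coefFun_eq n hl h1, oddFactorial, div_div]

/-- The coefficients of a uniform expansion are determined at every point in the range of `η`. -/
lemma IsUniformExpansion.unique {C D : ℕ → ℝ → ℝ} (hC : IsUniformExpansion C)
    (hD : IsUniformExpansion D) {l : ℝ} (hl : 0 < l) (n : ℕ) : C n (eta l) = D n (eta l) := by
  induction n using Nat.strong_induction_on with
  | _ n ih =>
  obtain ⟨K, hK⟩ := hC (n + 1)
  obtain ⟨L, hL⟩ := hD (n + 1)
  have hbound : ∀ᶠ a : ℝ in atTop, |C n (eta l) - D n (eta l)| ≤ (K + L) * a⁻¹ := by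
    filter_upwards [hK, hL, eventually_gt_atTop 0] with a hKa hLa ha
    have h1 := hKa l hl
    have h2 := hLa l hl
    have hr : 0 < √(2 * Real.pi * a) :=
      Real.sqrt_pos.mpr (by have := Real.pi_pos; positivity)
    rw [Finset.sum_range_succ] at h1 h2
    rw [Finset.sum_congr rfl fun i hi => by rw [ih i (Finset.mem_range.mp hi)]] at h1
    set E := Real.exp (-(1 / 2) * a * eta l ^ 2) / √(2 * Real.pi * a) with hE
    have hE0 : 0 < E := by positivity
    generalize ∑ x ∈ Finset.range n, D x (eta l) / a ^ x = S at h1 h2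
    have h3 : |E * ((C n (eta l) - D n (eta l)) / a ^ n)| ≤ (K + L) * (E / a ^ (n + 1)) := by
      rw [abs_le] at h1 h2 ⊢
      rw [sub_div, mul_sub]
      constructor <;> linarith [h1.1, h1.2, h2.1, h2.2]
    rw [abs_mul, abs_of_pos hE0, abs_div, abs_of_pos (pow_pos ha n)] at h3
    have h4 : (K + L) * (E / a ^ (n + 1)) = E * ((K + L) * a⁻¹ / a ^ n) := by
      rw [pow_succ]; field_simp
    rw [h4] at h3
    exact (div_le_div_iff_of_pos_right (pow_pos ha n)).mp (le_of_mul_le_mul_left h3 hE0)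
  have hlim : Tendsto (fun a : ℝ => (K + L) * a⁻¹) atTop (𝓝 0) := by
    simpa using tendsto_inv_atTop_zero.const_mul (K + L)
  have h0 := ge_of_tendsto hlim hbound
  exact sub_eq_zero.mp (abs_nonpos_iff.mp h0)

lemma IsPolynomialPart.unique {C D : ℕ → ℝ → ℝ} {P Q : ℕ → Polynomial ℝ}
    (hP : IsPolynomialPart C P) (hQ : IsPolynomialPart D Q)
    (h : ∀ n l, 0 < l → C n (eta l) = D n (eta l)) (n : ℕ) : P n = Q n := by
  refine Polynomial.eq_of_infinite_eval_eq _ _ ((Set.Ioi_infinite (0 : ℝ)).mono fun x hx => ?_)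
  have hx0 : (0 : ℝ) < x := hx
  have h1 := hP n (1 + x) (by linarith) (by linarith)
  have h2 := hQ n (1 + x) (by linarith) (by linarith)
  rw [h n _ (by linarith), h2] at h1
  have hs : ((-1 : ℝ) ^ n) ≠ 0 := pow_ne_zero _ (by norm_num)
  have h3 := sub_left_inj.mp (mul_left_cancel₀ hs h1)
  rw [add_sub_cancel_left] at h3
  exact ((div_left_inj' (pow_ne_zero _ hx0.ne')).mp h3).symm

end Temme

end

theorem mainTheorem3 :
    (∃ (C : ℕ → ℝ → ℝ) (Q : ℕ → Polynomial ℝ),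
      Temme.IsUniformExpansion C ∧ Temme.IsPolynomialPart C Q) ∧
    ∀ (C : ℕ → ℝ → ℝ) (Q : ℕ → Polynomial ℝ),
      Temme.IsUniformExpansion C → Temme.IsPolynomialPart C Q →
      ∀ n : ℕ,
        (Q n).natDegree ≤ 2 * n ∧
        ∀ k : ℕ, k ≤ 2 * n →
          (Q n).coeff k =
            ∑ j ∈ Finset.range (k + 1),
              (-1 : ℝ) ^ k * 2 ^ (n + j + 1) * Real.Gamma ((n : ℝ) + k + 3 / 2)
                / (√Real.pi * (2 * n + 2 * j + 1) * ((k - j)! : ℕ))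
                * ∑ i ∈ Finset.range (j + 1),
                    (-1 : ℝ) ^ i * (Nat.stirlingFirst (k + j + i) i : ℝ)
                      / (((j - i)! : ℕ) * ((k + j + i)! : ℕ)) := by
  refine ⟨⟨Temme.coef, Temme.polyPart, Temme.isUniformExpansion_coef,
    Temme.isPolynomialPart_coef⟩, fun C Q hC hQ n => ?_⟩
  rw [Temme.IsPolynomialPart.unique hQ Temme.isPolynomialPart_coef
    (fun n l hl => hC.unique Temme.isUniformExpansion_coef hl n) n]
  exact ⟨Temme.natDegree_polyPart_le n, Temme.coeff_polyPart_eq n⟩
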